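/- All graphs are finite and simple. The eigenvalues of a graph $G$ are the zeros of the characteristic polynomial of its adjacency matrix $A(G)$ (a real symmetric matrix); $G$ is called integral if all its eigenvalues are integers, and the nullity of $G$ is the dimension of the kernel of $A(G)$. Theorem. For every integer $h \ge 2$ there are, up to isomorphism, only finitely many integral trees with nullity $h$. -/

import Mathlib

namespace SimpleGraph

universe u

variable {V : Type u} [Fintype V] [DecidableEq V]

/-- A finite graph is integral if all its eigenvalues, i.e. all zeros of the characteristic
polynomial of its adjacency matrix, are integers. The adjacency matrix is a real symmetric matrix,
so all its eigenvalues are real and it suffices to consider its real zeros. -/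
def HasIntegralSpectrum (G : SimpleGraph V) [DecidableRel G.Adj] : Prop :=
  ∀ x : ℝ, (G.adjMatrix ℝ).charpoly.IsRoot x → ∃ z : ℤ, x = (z : ℝ)

/-- The nullity of a finite graph: the dimension of the kernel of its adjacency matrix. -/
noncomputable def nullity (G : SimpleGraph V) [DecidableRel G.Adj] : ℕ :=
  Module.finrank ℝ (LinearMap.ker (Matrix.toLin' (G.adjMatrix ℝ)))

end SimpleGraph

/-! It suffices to bound the number n of vertices. The characteristic polynomial of a forest is its
matching polynomial, so for a tree the inverse squares of the nonzero eigenvalues sum to 2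
m(μ-1)/m(μ), where m(k) counts the matchings with k edges and μ is the maximum size. A double count
of edge removals bounds this below by n - 3h (`IsTree.card_sub_le_sum_inv_sq`). Integer eigenvalues
other than 0, 1, -1 contribute at most 1/4 each, so 1 or -1 has multiplicity at least n/2 - 2h
(`IsTree.exists_sign_card_le`). Isolating Parter vertices then shows that the tree is a disjoint
union of edges apart from O(h) vertices (`IsAcyclic.exists_core`), and edge counting turns nearly
all of these edges into pendant paths, called arms, hanging at O(h) vertices (`IsTree.exists_arms`).

If n is huge, a pigeonhole over scales (`Finset.exists_gap`) separates hubs with enormously many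
arms from a remainder whose size is tiny compared with the number of arms at any hub. Now
integrality acts as a spectral gap: an approximate eigenvector of small residual is close to a
genuine one. This gives in turn that each component of the remainder has Perron eigenvalue 1, hence
is a single edge (`IsHubDecomposition.perron_eq_one`); that hubs are neither adjacent nor joined
through both ends of a matching edge (`IsHubMatching.link_eq_zero`); and that hubs share no
neighbours, because large squares are sparse (`Matrix.IsHermitian.offDiag_eq_zero_of_sq`,
`IsHubMatching.not_shared`). By connectedness there is only one hub, and a null vector is determined
by its value there, so the nullity is at most 1, contrary to h ≥ 2. -/

namespace SimpleGraph

/-! ### Matchings and the characteristic polynomial of a forest -/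

open Finset Polynomial

/-- A permutation moving every vertex along an edge or not at all. -/
def IsMatchingPerm {V : Type*} (G : SimpleGraph V) (σ : Equiv.Perm V) : Prop :=
  ∀ v, σ v = v ∨ G.Adj v (σ v)

/-- The edge from v to σ v is a bridge; let S be the side of v. If σ does not return along this
edge, then the preimage of S under σ lies in S, so σ(S) = S by finiteness, which puts σ v on the
side of v. -/
theorem IsAcyclic.isMatchingPerm_involutive {V : Type*} [Finite V] {G : SimpleGraph V}
    (hG : G.IsAcyclic) {σ : Equiv.Perm V} (hσ : G.IsMatchingPerm σ) (v : V) : σ (σ v) = v := by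
  rcases hσ v with h | h
  · rw [h, h]
  have hb := isBridge_iff.1 (isAcyclic_iff_forall_adj_isBridge.1 hG h)
  set w := σ v with hw
  set G' := G.deleteEdges {s(v, w)} with hG'
  set S : Set V := {x | G'.Reachable v x} with hS
  have hSf : S.Finite := Set.toFinite S
  by_contra hne
  have key : ∀ x, σ x ∈ S → x ∈ S := by
    intro x hx
    rcases hσ x with h1 | h1
    · rwa [h1] at hx
    by_cases he : s(x, σ x) = s(v, w)
    · rw [Sym2.eq_iff] at he
      rcases he with ⟨h2, h3⟩ | ⟨h2, h3⟩
      · rw [h2]; exact Reachable.refl v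
      · rw [h2] at h3; exact absurd h3 hne
    · have : G'.Adj x (σ x) := by
        rw [hG', deleteEdges_adj]; exact ⟨h1, he⟩
      exact Reachable.trans hx this.symm.reachable
  have hsub : S ⊆ σ '' S := fun x hx => ⟨σ.symm x, key _ (by simpa using hx), by simp⟩
  have heq : S = σ '' S := by
    apply Set.eq_of_subset_of_ncard_le hsub _ (Set.toFinite _)
    rw [Set.ncard_image_of_injective S σ.injective]
  have : w ∈ S := by
    rw [heq]; exact ⟨v, Reachable.refl v, rfl⟩
  exact hb this

/-- `par` is the next vertex on the path to a chosen root. The form of the statement charges every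
edge to exactly one of its ends. -/
theorem IsTree.exists_parent {V : Type*} {G : SimpleGraph V} (hG : G.IsTree) :
    ∃ par : V → V, ∀ u v, G.Adj u v →
      (par u = v ∧ par v ≠ u) ∨ (par v = u ∧ par u ≠ v) := by
  classical
  obtain ⟨r⟩ := hG.1.nonempty
  choose p hp hu using fun v => hG.existsUnique_path v r
  refine ⟨fun v => (p v).snd, ?_⟩
  have step : ∀ u v, G.Adj u v → v ∈ (p u).support →
      (p u).snd = v ∧ (p v).length + 1 = (p u).length := by
    intro u v huv hv
    have h1 := hG.2.eq_snd_of_adj_start (hp u) huv hv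
    refine ⟨h1.symm, ?_⟩
    have hnn : ¬ (p u).Nil := by
      intro hn
      have := hn.eq
      subst this
      have h2 := (Walk.isPath_iff_nil.1 (hp u))
      rw [Walk.nil_iff_support_eq.1 h2] at hv
      simp at hv
      exact huv.ne hv.symm
    have h3 : (p u).tail.copy h1.symm rfl = p v := by
      apply hu
      rw [Walk.isPath_copy]
      exact (hp u).tail
    rw [← h3, Walk.length_copy]
    exact Walk.length_tail_add_one hnn
  have step2 : ∀ u v, G.Adj u v → v ∉ (p u).support → (p v).snd = u ∧
      (p u).length + 1 = (p v).length := by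
    intro u v huv hv
    have h1 : Walk.cons huv.symm (p u) = p v := hu v _ ((hp u).cons hv)
    rw [← h1]
    simp
  intro u v huv
  by_cases hv : v ∈ (p u).support
  · obtain ⟨h1, h2⟩ := step u v huv hv
    refine Or.inl ⟨h1, fun h3 => ?_⟩
    by_cases h4 : u ∈ (p v).support
    · have := (step v u huv.symm h4).2
      omega
    · have : u ∈ (p v).support := h3 ▸ (p v).getVert_mem_support 1
      exact h4 this
  · obtain ⟨h1, h2⟩ := step2 u v huv hv
    refine Or.inr ⟨h1, fun h3 => ?_⟩
    exact hv (h3 ▸ (p u).getVert_mem_support 1)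

end SimpleGraph

theorem Equiv.Perm.sign_of_involutive {α : Type*} [Fintype α] [DecidableEq α]
    {σ : Equiv.Perm α} (hσ : ∀ v, σ (σ v) = v) :
    2 ∣ σ.support.card ∧ Equiv.Perm.sign σ = (-1) ^ (σ.support.card / 2) := by
  have h2 : σ ^ 2 = 1 := by ext v; simp [pow_two, hσ]
  have hr : σ.cycleType = Multiset.replicate σ.cycleType.card 2 := by
    rw [Multiset.eq_replicate]
    refine ⟨rfl, fun b hb => ?_⟩
    have h3 := Equiv.Perm.two_le_of_mem_cycleType hb
    have h4 := (Equiv.Perm.dvd_of_mem_cycleType hb).trans (orderOf_dvd_of_pow_eq_one h2)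
    exact le_antisymm (Nat.le_of_dvd two_pos h4) h3
  have hs : σ.cycleType.sum = 2 * σ.cycleType.card := by
    conv_lhs => rw [hr]
    simp [mul_comm]
  rw [Equiv.Perm.sum_cycleType] at hs
  refine ⟨⟨_, hs⟩, ?_⟩
  rw [Equiv.Perm.sign_of_cycleType, Equiv.Perm.sum_cycleType, hs,
    Nat.mul_div_cancel_left _ two_pos, pow_add, pow_mul]
  simp

namespace SimpleGraph

open Finset Polynomial

open Classical in
/-- The matchings with `j` edges of a forest, as permutations. -/
noncomputable def matchingPerms {V : Type*} [Fintype V] [DecidableEq V] (G : SimpleGraph V) (j : ℕ) :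
    Finset (Equiv.Perm V) :=
  univ.filter fun σ => G.IsMatchingPerm σ ∧ σ.support.card = 2 * j

section charpoly

variable {V : Type*} [Fintype V] [DecidableEq V] {G : SimpleGraph V}

theorem mem_matchingPerms {j : ℕ} {σ : Equiv.Perm V} :
    σ ∈ G.matchingPerms j ↔ G.IsMatchingPerm σ ∧ σ.support.card = 2 * j := by
  simp [matchingPerms]

variable [DecidableRel G.Adj]

theorem prod_charmatrix_adjMatrix (σ : Equiv.Perm V) :
    ∏ i, (G.adjMatrix ℝ).charmatrix (σ i) i =
      open Classical in
      if G.IsMatchingPerm σ then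
        (-1) ^ σ.support.card * X ^ (Fintype.card V - σ.support.card) else 0 := by
  classical
  have hent : ∀ i, (G.adjMatrix ℝ).charmatrix (σ i) i =
      if σ i = i then X else if G.Adj i (σ i) then -1 else 0 := by
    intro i
    rw [Matrix.charmatrix_apply, adjMatrix_apply, Matrix.diagonal_apply]
    by_cases h : σ i = i
    · simp [h]
    · simp only [h, if_false]
      by_cases h2 : G.Adj i (σ i)
      · simp [h2, h2.symm]
      · have : ¬ G.Adj (σ i) i := fun h => h2 h.symm
        simp [h2, this]
  split_ifs with hσ
  · have h1 : ∀ i, (G.adjMatrix ℝ).charmatrix (σ i) i =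
        if i ∈ σ.support then -1 else X := by
      intro i
      rw [hent]
      simp only [Equiv.Perm.mem_support]
      rcases hσ i with h | h
      · simp [h]
      · simp [h, h.ne']
    rw [prod_congr rfl fun i _ => h1 i, prod_ite]
    simp only [prod_const]
    have h2 : univ.filter (fun i => i ∈ σ.support) = σ.support := by ext; simp
    have h3 : univ.filter (fun i => i ∉ σ.support) = univ \ σ.support := by ext; simp
    rw [h2, h3, card_sdiff_of_subset (subset_univ _), card_univ]
  · simp only [IsMatchingPerm, not_forall, not_or] at hσ
    obtain ⟨v, h1, h2⟩ := hσ
    apply prod_eq_zero (mem_univ v)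
    rw [hent]
    simp [h1, h2]

/-- In the Leibniz expansion only permutations along edges survive. In a forest these are products
of disjoint transpositions, so the sign depends only on the size of the support, which is even. -/
theorem IsAcyclic.coeff_charpoly (hG : G.IsAcyclic) (k : ℕ) (hk : k ≤ Fintype.card V) :
    (G.adjMatrix ℝ).charpoly.coeff (Fintype.card V - k) =
      if Even k then (-1) ^ (k / 2) * ((G.matchingPerms (k / 2)).card : ℝ) else 0 := by
  classical
  rw [Matrix.charpoly, Matrix.det_apply, finsetSum_coeff]
  have hterm : ∀ σ : Equiv.Perm V,
      (Equiv.Perm.sign σ • ∏ i, (G.adjMatrix ℝ).charmatrix (σ i) i).coeff (Fintype.card V - k) =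
        if Even k ∧ σ ∈ G.matchingPerms (k / 2) then (-1) ^ (k / 2) else 0 := by
    intro σ
    rw [prod_charmatrix_adjMatrix]
    by_cases hσ : G.IsMatchingPerm σ
    · obtain ⟨h2, hs⟩ := Equiv.Perm.sign_of_involutive (hG.isMatchingPerm_involutive hσ)
      have hev : Even σ.support.card := even_iff_two_dvd.2 h2
      have hle : σ.support.card ≤ Fintype.card V := card_le_univ _
      rw [if_pos hσ, hs, hev.neg_one_pow, one_mul]
      have : (((-1 : ℤˣ) ^ (σ.support.card / 2)) • (X ^ (Fintype.card V - σ.support.card) : ℝ[X]))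
          = C ((-1) ^ (σ.support.card / 2)) * X ^ (Fintype.card V - σ.support.card) := by
        rw [Units.smul_def]
        simp
      rw [this, coeff_C_mul, coeff_X_pow]
      simp only [mem_matchingPerms]
      by_cases hc : σ.support.card = k
      · rw [if_pos (by rw [hc]), if_pos ⟨hc ▸ hev, hσ, by rw [hc]; exact (Nat.mul_div_cancel' (hc ▸ h2)).symm⟩, hc, mul_one]
      · rw [if_neg (by omega), if_neg, mul_zero]
        rintro ⟨h3, -, h4⟩
        apply hc
        rw [h4]
        exact Nat.mul_div_cancel' (even_iff_two_dvd.1 h3)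
    · rw [if_neg hσ, if_neg (fun h => hσ (mem_matchingPerms.1 h.2).1)]
      simp
  rw [sum_congr rfl fun σ _ => hterm σ]
  split_ifs with he
  · simp only [he, true_and]
    rw [← sum_filter, sum_const, filter_mem_eq_inter, univ_inter, nsmul_eq_mul, mul_comm]
  · simp [he]

end charpoly

end SimpleGraph

/-! ### Double counting of near-maximum matchings -/

namespace SimpleGraph

open Finset

variable {V : Type*} [Fintype V] [DecidableEq V] {G : SimpleGraph V}

theorem IsAcyclic.exists_erase_matchingPerm (hG : G.IsAcyclic) {j : ℕ} {σ : Equiv.Perm V}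
    (hσ : σ ∈ G.matchingPerms (j + 1)) {d : V} (hd : σ d ≠ d) :
    ∃ N ∈ G.matchingPerms j, ∀ x, N x = if x = d ∨ x = σ d then x else σ x := by
  rw [mem_matchingPerms] at hσ
  obtain ⟨hm, hc⟩ := hσ
  have hinv := hG.isMatchingPerm_involutive hm
  have hN : ∀ x, (Equiv.swap d (σ d) * σ) x = if x = d ∨ x = σ d then x else σ x := by
    intro x
    rw [Equiv.Perm.mul_apply]
    split_ifs with h
    · rcases h with rfl | rfl
      · simp
      · rw [hinv]; simp
    · push Not at h
      rw [Equiv.swap_apply_of_ne_of_ne]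
      · intro h2; apply h.2; rw [← h2, hinv]
      · intro h2; exact h.1 (σ.injective h2)
  refine ⟨_, mem_matchingPerms.2 ⟨fun x => ?_, ?_⟩, hN⟩
  · rw [hN]
    split_ifs
    · exact Or.inl rfl
    · exact hm x
  · have : (Equiv.swap d (σ d) * σ).support = σ.support \ {d, σ d} := by
      ext x
      simp only [Equiv.Perm.mem_support, mem_sdiff, mem_insert, mem_singleton, hN]
      split_ifs with h <;> simp [h]
    rw [this, card_sdiff_of_subset, hc, card_pair hd.symm]
    · omega
    · intro x hx
      simp only [mem_insert, mem_singleton] at hx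
      rcases hx with rfl | rfl
      · simpa using hd
      · rw [Equiv.Perm.mem_support, hinv]; exact hd.symm


theorem exists_insert_matchingPerm {j : ℕ} {N : Equiv.Perm V}
    (hN : N ∈ G.matchingPerms j) {a e : V} (hae : G.Adj a e) (ha : N a = a) (he : N e = e) :
    ∃ σ ∈ G.matchingPerms (j + 1), ∀ x, σ x = if x = a then e else if x = e then a else N x := by
  rw [mem_matchingPerms] at hN
  obtain ⟨hm, hc⟩ := hN
  have hval : ∀ x, (Equiv.swap a e * N) x = if x = a then e else if x = e then a else N x := by
    intro x
    rw [Equiv.Perm.mul_apply]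
    split_ifs with h h'
    · rw [h, ha]; simp
    · rw [h', he]; simp
    · rw [Equiv.swap_apply_of_ne_of_ne]
      · intro h2; exact h (N.injective (h2.trans ha.symm))
      · intro h2; exact h' (N.injective (h2.trans he.symm))
  refine ⟨_, mem_matchingPerms.2 ⟨fun x => ?_, ?_⟩, hval⟩
  · rw [hval]
    split_ifs with h h'
    · exact Or.inr (h ▸ hae)
    · exact Or.inr (h' ▸ hae.symm)
    · exact hm x
  · have : (Equiv.swap a e * N).support = insert a (insert e N.support) := by
      ext x
      simp only [Equiv.Perm.mem_support, mem_insert, hval]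
      split_ifs with h h'
      · simp [h, hae.ne']
      · simp [h', hae.ne]
      · simp [h, h']
    rw [this, card_insert_of_notMem, card_insert_of_notMem, hc]
    · omega
    · simpa using he
    · simp [hae.ne, ha]

/-- Naming each matching edge by its child end counts it once. -/
theorem IsAcyclic.card_parent_edges (hG : G.IsAcyclic) {par : V → V}
    (hpar : ∀ u v, G.Adj u v → (par u = v ∧ par v ≠ u) ∨ (par v = u ∧ par u ≠ v))
    {j : ℕ} {σ : Equiv.Perm V} (hσ : σ ∈ G.matchingPerms j) :
    (univ.filter fun d => σ d = par d ∧ σ d ≠ d).card = j := by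
  rw [mem_matchingPerms] at hσ
  obtain ⟨hm, hc⟩ := hσ
  have hinv := hG.isMatchingPerm_involutive hm
  set C := univ.filter fun d => σ d = par d ∧ σ d ≠ d with hC
  have h1 : σ.support = C ∪ C.image σ := by
    ext x
    simp only [Equiv.Perm.mem_support, mem_union, hC, mem_filter, mem_univ, true_and, mem_image]
    constructor
    · intro hx
      have hadj := (hm x).resolve_left hx
      rcases hpar _ _ hadj with h | h
      · exact Or.inl ⟨h.1.symm, hx⟩
      · refine Or.inr ⟨σ x, ⟨?_, ?_⟩, hinv x⟩
        · rw [hinv, h.1]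
        · rw [hinv]; exact hx.symm
    · rintro (h | ⟨y, hy, rfl⟩)
      · exact h.2
      · rw [hinv]; exact hy.2.symm
  have h2 : Disjoint C (C.image σ) := by
    rw [Finset.disjoint_left]
    intro x hx hx'
    simp only [hC, mem_filter, mem_univ, true_and, mem_image] at hx hx'
    obtain ⟨y, hy, rfl⟩ := hx'
    rw [hinv] at hx
    have hadj := (hm y).resolve_left hy.2
    rcases hpar _ _ hadj with h | h
    · exact h.2 hx.1.symm
    · exact h.2 hy.1.symm
  have h3 := congrArg Finset.card h1
  rw [card_union_of_disjoint h2, card_image_of_injective _ σ.injective, hc] at h3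
  omega

/-- In a tree whose maximum matchings have `j + 1` edges and miss `h` vertices, an average matching
with `j` edges extends to few maximum matchings. -/
theorem IsTree.card_matchingPerms_le (hG : G.IsTree) {j h : ℕ}
    (hn : Fintype.card V = 2 * (j + 1) + h) (hmax : G.matchingPerms (j + 2) = ∅) :
    (j + 1) * (G.matchingPerms (j + 1)).card ≤
      (G.matchingPerms j).card + h * (G.matchingPerms (j + 1)).card := by
  classical
  obtain ⟨par, hpar⟩ := hG.exists_parent
  have hA := hG.2
  -- Pairs of a maximum matching and one of its edges, the edge given by its child end d.
  set P : Finset (Σ _ : Equiv.Perm V, V) := (G.matchingPerms (j + 1)).sigma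
    fun σ => univ.filter fun d => σ d = par d ∧ σ d ≠ d with hP
  have hPcard : P.card = (j + 1) * (G.matchingPerms (j + 1)).card := by
    rw [hP, card_sigma, sum_congr rfl fun σ hσ => hA.card_parent_edges hpar hσ]
    simp [mul_comm]
  have hmemP : ∀ p : (Σ _ : Equiv.Perm V, V), p ∈ P ↔
      p.1 ∈ G.matchingPerms (j + 1) ∧ p.1 p.2 = par p.2 ∧ p.1 p.2 ≠ p.2 := by
    intro p; simp [hP]
  -- In a bad pair the edge can slide: `par d` has a neighbour e ≠ d missed by the matching.
  let bad : (Σ _ : Equiv.Perm V, V) → Prop := fun p =>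
    ∃ e, e ≠ p.2 ∧ p.1 e = e ∧ G.Adj (par p.2) e
  -- On good pairs, deleting the edge is injective. If two pairs with distinct child ends leave the
  -- same matching N, their edges either share a vertex, which makes one of the pairs bad, or are
  -- disjoint, and then adding both to N exceeds the maximum size.
  have hgood : (P.filter fun p => ¬ bad p).card ≤ (G.matchingPerms j).card := by
    apply card_le_card_of_forall_subsingleton
      (fun (p : Σ _ : Equiv.Perm V, V) (N : Equiv.Perm V) =>
        ∀ x, N x = if x = p.2 ∨ x = p.1 p.2 then x else p.1 x)
    · intro p hp
      rw [mem_filter, hmemP] at hp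
      exact hA.exists_erase_matchingPerm hp.1.1 hp.1.2.2
    · rintro N hN ⟨σ₁, d₁⟩ ⟨h1, hN1⟩ ⟨σ₂, d₂⟩ ⟨h2, hN2⟩
      simp only at hN1 hN2
      rw [mem_filter, hmemP] at h1 h2
      obtain ⟨⟨hm1, hp1, hd1⟩, hb1⟩ := h1
      obtain ⟨⟨hm2, hp2, hd2⟩, hb2⟩ := h2
      simp only at hm1 hp1 hd1 hm2 hp2 hd2
      have hM1 := (mem_matchingPerms.1 hm1).1
      have hM2 := (mem_matchingPerms.1 hm2).1
      have hi1 := hA.isMatchingPerm_involutive hM1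
      have hi2 := hA.isMatchingPerm_involutive hM2
      have ha1 : G.Adj d₁ (par d₁) := hp1 ▸ (hM1 d₁).resolve_left hd1
      have ha2 : G.Adj d₂ (par d₂) := hp2 ▸ (hM2 d₂).resolve_left hd2
      rw [hp1] at hN1
      rw [hp2] at hN2
      have fN1 : N d₁ = d₁ := by rw [hN1]; simp
      have fN2 : N d₂ = d₂ := by rw [hN2]; simp
      have gN1 : N (par d₁) = par d₁ := by rw [hN1]; simp
      have gN2 : N (par d₂) = par d₂ := by rw [hN2]; simp
      have val1 : ∀ x, N x = x → x ≠ d₁ → x ≠ par d₁ → σ₁ x = x := by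
        intro x hx h3 h4
        have := hN1 x
        rw [if_neg (by tauto), hx] at this
        exact this.symm
      have val2 : ∀ x, N x = x → x ≠ d₂ → x ≠ par d₂ → σ₂ x = x := by
        intro x hx h3 h4
        have := hN2 x
        rw [if_neg (by tauto), hx] at this
        exact this.symm
      by_cases hdd : d₁ = d₂
      · subst hdd
        have : σ₁ = σ₂ := by
          ext x
          by_cases hx : x = d₁
          · rw [hx, hp1, hp2]
          by_cases hx' : x = par d₁
          · have e1 := hi1 d₁
            have e2 := hi2 d₁
            rw [hp1] at e1
            rw [hp2] at e2
            rw [hx', e1, e2]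
          have e1 := hN1 x
          rw [hN2 x, if_neg (by tauto), if_neg (by tauto)] at e1
          exact e1.symm
        rw [this]
      exfalso
      by_cases hpp : par d₁ = par d₂
      · apply hb1
        refine ⟨d₂, fun h => hdd h.symm, val1 _ fN2 (fun h => hdd h.symm) ?_, ?_⟩
        · rw [hpp]; exact ha2.ne
        · simp only [hpp]; exact ha2.symm
      by_cases h12 : par d₁ = d₂
      · have hne : par d₂ ≠ d₁ := by
          rcases hpar _ _ ha1 with h | h
          · rw [h12] at h; exact h.2
          · exact absurd rfl h.2
        apply hb1
        refine ⟨par d₂, hne, val1 _ gN2 hne (fun h => hpp h.symm), ?_⟩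
        simp only [h12]; exact ha2
      by_cases h21 : par d₂ = d₁
      · have hne : par d₁ ≠ d₂ := h12
        apply hb2
        refine ⟨par d₁, hne, val2 _ gN1 hne hpp, ?_⟩
        simp only [h21]; exact ha1
      obtain ⟨τ, hτ, -⟩ := exists_insert_matchingPerm hm1 ha2
        (val1 _ fN2 (fun h => hdd h.symm) (fun h => h12 h.symm))
        (val1 _ gN2 h21 (fun h => hpp h.symm))
      rw [hmax] at hτ
      simp at hτ
  -- For bad pairs, replace the edge from d to `par d` by the one from `par d` to e. The result has
  -- the same size and misses d; together with d it determines the original pair. Each matching with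
  -- j + 1 edges misses h vertices.
  have hbad : (P.filter fun p => bad p).card ≤ h * (G.matchingPerms (j + 1)).card := by
    set Q : Finset (Σ _ : Equiv.Perm V, V) := (G.matchingPerms (j + 1)).sigma
      fun σ => univ.filter fun d => σ d = d with hQ
    have hQcard : Q.card = h * (G.matchingPerms (j + 1)).card := by
      rw [hQ, card_sigma, sum_congr rfl (g := fun _ => h)]
      · simp [mul_comm]
      · intro σ hσ
        have := (mem_matchingPerms.1 hσ).2
        have h2 : univ.filter (fun d => σ d = d) = univ \ σ.support := by ext; simp
        rw [h2, card_sdiff_of_subset (subset_univ _), card_univ, this]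
        omega
    rw [← hQcard]
    apply card_le_card_of_forall_subsingleton
      (fun (p q : Σ _ : Equiv.Perm V, V) => p.2 = q.2 ∧ ∃ e, e ≠ p.2 ∧ p.1 e = e ∧
        ∀ x, q.1 x = if x = par p.2 then e else if x = e then par p.2 else
          if x = p.2 then x else p.1 x)
    · intro p hp
      rw [mem_filter, hmemP] at hp
      obtain ⟨⟨hm, hpp, hd⟩, e, he, hfe, hae⟩ := hp
      obtain ⟨N, hN, hNx⟩ := hA.exists_erase_matchingPerm hm hd
      rw [hpp] at hNx
      obtain ⟨τ, hτ, hτx⟩ := exists_insert_matchingPerm hN hae (by rw [hNx]; simp)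
        (by rw [hNx, hfe]; simp)
      have hval : ∀ x, τ x = if x = par p.2 then e else if x = e then par p.2 else
          if x = p.2 then x else p.1 x := by
        intro x
        rw [hτx, hNx]
        split_ifs <;> simp_all
      refine ⟨⟨τ, p.2⟩, ?_, rfl, e, he, hfe, hval⟩
      rw [hQ, mem_sigma]
      refine ⟨hτ, ?_⟩
      rw [mem_filter]
      refine ⟨mem_univ _, ?_⟩
      simp only
      rw [hval, if_neg (hpp ▸ hd.symm), if_neg he.symm, if_pos rfl]
    · rintro ⟨τ, d⟩ - ⟨σ₁, d₁⟩ ⟨h1, hd1, e₁, he1, hf1, hv1⟩ ⟨σ₂, d₂⟩ ⟨h2, hd2, e₂, he2, hf2, hv2⟩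
      simp only at hd1 hd2 hf1 hf2 hv1 hv2 he1 he2
      subst hd1
      subst hd2
      rw [mem_filter, hmemP] at h1 h2
      have hee : e₁ = e₂ := by
        have e1 := hv1 (par d₂)
        have e2 := hv2 (par d₂)
        rw [if_pos rfl] at e1 e2
        exact e1.symm.trans e2
      subst hee
      have hi1 := hA.isMatchingPerm_involutive (mem_matchingPerms.1 h1.1.1).1
      have hi2 := hA.isMatchingPerm_involutive (mem_matchingPerms.1 h2.1.1).1
      have : σ₁ = σ₂ := by
        ext x
        by_cases hx : x = d₂
        · rw [hx, h1.1.2.1, h2.1.2.1]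
        by_cases hx' : x = par d₂
        · have e1 := hi1 d₂
          have e2 := hi2 d₂
          rw [h1.1.2.1] at e1
          rw [h2.1.2.1] at e2
          rw [hx', e1, e2]
        by_cases hxe : x = e₁
        · rw [hxe, hf1, hf2]
        have e1 := hv1 x
        rw [hv2 x, if_neg hx', if_neg hxe, if_neg hx, if_neg hx', if_neg hxe, if_neg hx] at e1
        exact e1.symm
      rw [this]
  rw [← hPcard, ← card_filter_add_card_filter_not (s := P) (fun p => bad p)]
  omega

end SimpleGraph

/-! ### Inverse squares of eigenvalues, and the eigenvalues 1 and -1 -/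

section

open Finset Polynomial

/-- Newton's identities for ∏ (1 - X / a i), obtained by dividing by the constant coefficient. -/
theorem Polynomial.coeff_prod_X_sub_C_low {ι : Type*} [DecidableEq ι] (s : Finset ι) (a : ι → ℝ)
    (ha : ∀ i ∈ s, a i ≠ 0) :
    (∏ i ∈ s, (X - C (a i))).coeff 0 ≠ 0 ∧
    (∏ i ∈ s, (X - C (a i))).coeff 1 =
      -(∏ i ∈ s, (X - C (a i))).coeff 0 * ∑ i ∈ s, (a i)⁻¹ ∧
    2 * (∏ i ∈ s, (X - C (a i))).coeff 2 = (∏ i ∈ s, (X - C (a i))).coeff 0 *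
      ((∑ i ∈ s, (a i)⁻¹) ^ 2 - ∑ i ∈ s, ((a i)⁻¹) ^ 2) := by
  induction s using Finset.induction_on with
  | empty => simp [coeff_one]
  | insert i s hi ih =>
    obtain ⟨h0, h1, h2⟩ := ih fun j hj => ha j (mem_insert_of_mem hj)
    have hai := ha i (mem_insert_self _ _)
    rw [prod_insert hi, sum_insert hi, sum_insert hi]
    set g := ∏ i ∈ s, (X - C (a i)) with hg
    have c0 : ((X - C (a i)) * g).coeff 0 = - a i * g.coeff 0 := by
      rw [sub_mul, coeff_sub, coeff_C_mul]; simp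
    have c1 : ((X - C (a i)) * g).coeff 1 = g.coeff 0 - a i * g.coeff 1 := by
      rw [sub_mul, coeff_sub, coeff_C_mul]
      simp [coeff_X_mul g 0]
    have c2 : ((X - C (a i)) * g).coeff 2 = g.coeff 1 - a i * g.coeff 2 := by
      rw [sub_mul, coeff_sub, coeff_C_mul]
      simp [coeff_X_mul g 1]
    rw [c0, c1, c2]
    refine ⟨mul_ne_zero (neg_ne_zero.2 hai) h0, ?_, ?_⟩
    · rw [h1]; field_simp; ring
    · have : 2 * (g.coeff 1 - a i * g.coeff 2) = 2 * g.coeff 1 - a i * (2 * g.coeff 2) := by ring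
      rw [this, h1, h2]; field_simp; ring

namespace SimpleGraph

theorem isHermitian_adjMatrix_real {V : Type*} (G : SimpleGraph V) [DecidableRel G.Adj] :
    (G.adjMatrix ℝ).IsHermitian := by
  rw [Matrix.IsHermitian, Matrix.conjTranspose_eq_transpose_of_trivial]
  exact G.isSymm_adjMatrix

variable {V : Type*} [Fintype V] [DecidableEq V] {G : SimpleGraph V} [DecidableRel G.Adj]

theorem nullity_eq_card_eigenvalues (G : SimpleGraph V) [DecidableRel G.Adj] :
    G.nullity + (univ.filter fun i => G.isHermitian_adjMatrix_real.eigenvalues i ≠ 0).card =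
      Fintype.card V := by
  have h1 := G.isHermitian_adjMatrix_real.rank_eq_card_non_zero_eigs
  rw [Fintype.card_subtype] at h1
  rw [← h1, nullity, Matrix.rank, ← Matrix.toLin'_apply', add_comm,
    LinearMap.finrank_range_add_finrank_ker]
  simp

theorem HasIntegralSpectrum.eigenvalues_int (hI : G.HasIntegralSpectrum) (i : V) :
    ∃ z : ℤ, G.isHermitian_adjMatrix_real.eigenvalues i = z := by
  apply hI
  rw [G.isHermitian_adjMatrix_real.charpoly_eq, IsRoot.def, eval_prod]
  exact prod_eq_zero (mem_univ i) (by simp)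

/-- After removing the factor X ^ h, the two lowest even coefficients are, up to sign, the numbers
of matchings with j + 1 and j edges, and the linear coefficient vanishes. Hence the inverse
eigenvalues sum to 0 and their squares to twice the ratio of these numbers, which is at least 2 (j +
1 - h) = n - 3 h. -/
theorem IsTree.card_sub_le_sum_inv_sq (hG : G.IsTree) :
    (Fintype.card V : ℝ) - 3 * G.nullity ≤
      ∑ i ∈ univ.filter (fun i => G.isHermitian_adjMatrix_real.eigenvalues i ≠ 0),
        ((G.isHermitian_adjMatrix_real.eigenvalues i)⁻¹) ^ 2 := by
  have hA := hG.2
  set lam := G.isHermitian_adjMatrix_real.eigenvalues with hlam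
  set s := univ.filter (fun i => lam i ≠ 0) with hs
  set h := G.nullity with hh
  have hcard : h + s.card = Fintype.card V := G.nullity_eq_card_eigenvalues
  have hchar : (G.adjMatrix ℝ).charpoly = (∏ i ∈ s, (X - C (lam i))) * X ^ h := by
    rw [G.isHermitian_adjMatrix_real.charpoly_eq]
    rw [← prod_filter_mul_prod_filter_not univ (fun i => lam i ≠ 0)]
    congr 1
    rw [prod_congr rfl (g := fun _ => (X : ℝ[X]))]
    · rw [prod_const]
      congr 1
      have : s.card + _ = _ :=
        card_filter_add_card_filter_not (s := (univ : Finset V)) (fun i => lam i ≠ 0)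
      rw [card_univ] at this
      omega
    · intro i hi
      simp only [mem_filter, not_not] at hi
      have : G.isHermitian_adjMatrix_real.eigenvalues i = 0 := hi.2
      simp [this]
  obtain ⟨g0, g1, g2⟩ := Polynomial.coeff_prod_X_sub_C_low s lam (fun i hi => (mem_filter.1 hi).2)
  set g := ∏ i ∈ s, (X - C (lam i)) with hg
  have hco : ∀ k ≤ s.card, g.coeff k = (G.adjMatrix ℝ).charpoly.coeff (Fintype.card V - (s.card - k)) := by
    intro k hk
    have : Fintype.card V - (s.card - k) = k + h := by omega
    rw [this, hchar, coeff_mul_X_pow]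
  rcases Nat.eq_zero_or_pos s.card with hs0 | hpos
  · rw [card_eq_zero] at hs0
    rw [hs0, ← hcard, hs0]
    simp
    have : (0 : ℝ) ≤ h := by positivity
    linarith
  have e0 := hco 0 (by omega)
  rw [hA.coeff_charpoly _ (by omega)] at e0
  have hev : Even s.card := by
    by_contra hodd
    rw [Nat.sub_zero, if_neg hodd] at e0
    exact g0 e0
  rw [Nat.sub_zero, if_pos hev] at e0
  obtain ⟨μ', hμ'⟩ := hev
  obtain ⟨j, rfl⟩ : ∃ j, μ' = j + 1 := ⟨μ' - 1, by omega⟩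
  have e1 := hco 1 (by omega)
  rw [hA.coeff_charpoly _ (by omega), if_neg (by rw [hμ', Nat.not_even_iff]; omega)] at e1
  have e2 := hco 2 (by omega)
  have hd1 : s.card / 2 = j + 1 := by omega
  have hd2 : (s.card - 2) / 2 = j := by omega
  rw [hA.coeff_charpoly _ (by omega), if_pos (by rw [hμ', Nat.even_iff]; omega), hd2] at e2
  rw [hd1] at e0
  -- A larger matching would give a nonzero coefficient below X ^ h.
  have hmax : G.matchingPerms (j + 2) = ∅ := by
    by_contra hne
    rw [← Ne, ← nonempty_iff_ne_empty] at hne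
    obtain ⟨σ, hσ⟩ := hne
    have hc := (mem_matchingPerms.1 hσ).2
    have hle : σ.support.card ≤ Fintype.card V := card_le_univ _
    have := hA.coeff_charpoly (2 * (j + 2)) (by omega)
    rw [if_pos (even_two_mul _), Nat.mul_div_cancel_left _ two_pos, hchar, coeff_mul_X_pow',
      if_neg (by omega)] at this
    have h3 : ((G.matchingPerms (j + 2)).card : ℝ) ≠ 0 := by
      rw [Nat.cast_ne_zero, Finset.card_ne_zero]; exact ⟨σ, hσ⟩
    exact mul_ne_zero (pow_ne_zero _ (by norm_num)) h3 this.symm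
  have hcount := hG.card_matchingPerms_le (j := j) (h := h) (by omega) hmax
  have hs1 : ∑ i ∈ s, (lam i)⁻¹ = 0 := by
    rw [e1] at g1
    rcases mul_eq_zero.1 g1.symm with h | h
    · exact absurd (neg_eq_zero.1 h) g0
    · exact h
  rw [hs1, e0, e2] at g2
  set a := ((G.matchingPerms (j + 1)).card : ℝ) with ha
  set b := ((G.matchingPerms j).card : ℝ) with hb
  have ha0 : 0 < a := by
    rw [e0] at g0
    have : a ≠ 0 := right_ne_zero_of_mul g0
    exact lt_of_le_of_ne (Nat.cast_nonneg _) this.symm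
  have hS : a * ∑ i ∈ s, ((lam i)⁻¹) ^ 2 = 2 * b := by
    rw [pow_succ] at g2
    have hp : ((-1 : ℝ) ^ j) ≠ 0 := pow_ne_zero _ (by norm_num)
    apply mul_left_cancel₀ hp
    linear_combination -g2
  have hcount' : ((j : ℝ) + 1) * a ≤ b + h * a := by
    have := (Nat.cast_le (α := ℝ)).2 hcount
    push_cast at this
    exact this
  have hcard' : (Fintype.card V : ℝ) = h + 2 * (j + 1) := by
    have : Fintype.card V = h + 2 * (j + 1) := by omega
    exact_mod_cast this
  have : a * ((Fintype.card V : ℝ) - 3 * h) ≤ a * ∑ i ∈ s, ((lam i)⁻¹) ^ 2 := by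
    rw [hS, hcard']; nlinarith
  exact le_of_mul_le_mul_left this ha0

/-- In an integral tree, one of `1`, `-1` is an eigenvalue of multiplicity close to half the number
of vertices. -/
theorem IsTree.exists_sign_card_le (hG : G.IsTree) (hI : G.HasIntegralSpectrum) :
    ∃ θ : ℝ, θ ^ 2 = 1 ∧ Fintype.card V ≤
      2 * (univ.filter fun i => G.isHermitian_adjMatrix_real.eigenvalues i = θ).card +
        4 * G.nullity := by
  have hsum := hG.card_sub_le_sum_inv_sq
  have hnul := G.nullity_eq_card_eigenvalues
  set lam := G.isHermitian_adjMatrix_real.eigenvalues with hlam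
  set s := univ.filter (fun i => lam i ≠ 0) with hs
  set h := G.nullity with hh
  set P := univ.filter (fun i => lam i = 1) with hP
  set N := univ.filter (fun i => lam i = -1) with hN
  have hPN : Disjoint P N := by
    rw [Finset.disjoint_left]
    intro i h1 h2
    simp only [hP, hN, mem_filter] at h1 h2
    rw [h1.2] at h2
    norm_num at h2
  have hsub : P ∪ N ⊆ s := by
    intro i hi
    simp only [hP, hN, hs, mem_union, mem_filter, mem_univ, true_and] at hi ⊢
    rcases hi with h | h <;> rw [h] <;> norm_num
  have hle : ∑ i ∈ s, ((lam i)⁻¹) ^ 2 ≤ ((P ∪ N).card : ℝ) + (s \ (P ∪ N)).card * (1 / 4) := by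
    rw [← sum_sdiff hsub, add_comm]
    apply add_le_add
    · rw [card_eq_sum_ones, Nat.cast_sum]
      apply sum_le_sum
      intro i hi
      simp only [hP, hN, mem_union, mem_filter, mem_univ, true_and] at hi
      rcases hi with h | h <;> rw [h] <;> norm_num
    · rw [← nsmul_eq_mul]
      apply sum_le_card_nsmul
      intro i hi
      simp only [hP, hN, hs, mem_sdiff, mem_union, mem_filter, mem_univ, true_and] at hi
      obtain ⟨z, hz⟩ := hI.eigenvalues_int i
      have hz : lam i = z := hz
      rw [hz] at hi ⊢
      have hz0 : z ≠ 0 := by exact_mod_cast hi.1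
      have hz1 : z ≠ 1 := by intro h; apply hi.2; left; exact_mod_cast h
      have hz2 : z ≠ -1 := by intro h; apply hi.2; right; exact_mod_cast h
      have h4 : (4 : ℤ) ≤ z ^ 2 := by
        rcases lt_or_gt_of_ne hz0 with h | h
        · nlinarith [show z ≤ -2 by omega]
        · nlinarith [show 2 ≤ z by omega]
      have h4' : (4 : ℝ) ≤ (z : ℝ) ^ 2 := by exact_mod_cast h4
      rw [inv_pow, one_div]
      exact inv_anti₀ (by norm_num) h4'
  have hc1 : (s \ (P ∪ N)).card + (P ∪ N).card = s.card := by
    rw [card_sdiff_add_card, union_eq_left.2 hsub]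
  have hc2 : (P ∪ N).card = P.card + N.card := card_union_of_disjoint hPN
  -- With p eigenvalues equal to 1 or -1, the bound n - 3h ≤ p + (n - h - p)/4 gives p ≥ n - 11h/3,
  -- weakened to n - 4h.
  have hkey : (Fintype.card V : ℝ) ≤ (P.card + N.card : ℕ) + 4 * h := by
    have r1 : ((s \ (P ∪ N)).card : ℝ) + (P ∪ N).card = s.card := by exact_mod_cast hc1
    have r2 : ((P ∪ N).card : ℝ) = (P.card + N.card : ℕ) := by exact_mod_cast hc2
    have r3 : (h : ℝ) + s.card = Fintype.card V := by exact_mod_cast hnul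
    have r4 : (0 : ℝ) ≤ h := by positivity
    linarith
  have hkey' : Fintype.card V ≤ (P.card + N.card) + 4 * h := by exact_mod_cast hkey
  rcases le_total P.card N.card with h | h
  · refine ⟨-1, by norm_num, ?_⟩
    change _ ≤ 2 * N.card + _
    omega
  · refine ⟨1, by norm_num, ?_⟩
    change _ ≤ 2 * P.card + _
    omega

end SimpleGraph

end

/-! ### Parter vertices and eigenvalues of large multiplicity -/

namespace SimpleGraph

open Finset

section eigenfunctions

variable {V : Type*} [Fintype V]

open Classical in
/-- The functions `f` with `∑_{y ~ x} f y = θ f x` at every vertex `x`. -/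
noncomputable def eigenfunctions (F : SimpleGraph V) (θ : ℝ) : Submodule ℝ (V → ℝ) :=
  Module.End.eigenspace (Matrix.toLin' (F.adjMatrix ℝ)) θ

theorem mem_eigenfunctions {F : SimpleGraph V} [DecidableRel F.Adj] {θ : ℝ} {f : V → ℝ} :
    f ∈ F.eigenfunctions θ ↔ ∀ x, ∑ y ∈ univ.filter (F.Adj x), f y = θ * f x := by
  classical
  unfold eigenfunctions
  rw [Module.End.mem_eigenspace_iff, Matrix.toLin'_apply, funext_iff]
  refine forall_congr' fun x => ?_
  rw [adjMatrix_mulVec_apply]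
  have : F.neighborFinset x = univ.filter (F.Adj x) := by ext; simp
  rw [Pi.smul_apply, smul_eq_mul]
  convert Iff.rfl using 3
  ext; simp

theorem card_eigenvalues_le_finrank_eigenfunctions [DecidableEq V] (G : SimpleGraph V)
    [DecidableRel G.Adj] (θ : ℝ) :
    (univ.filter fun i => G.isHermitian_adjMatrix_real.eigenvalues i = θ).card ≤
      Module.finrank ℝ (G.eigenfunctions θ) := by
  set hA := G.isHermitian_adjMatrix_real
  let b := hA.eigenvectorBasis
  have hmem : ∀ i : {i // hA.eigenvalues i = θ}, (b i).ofLp ∈ G.eigenfunctions θ := by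
    rintro ⟨i, hi⟩
    rw [mem_eigenfunctions]
    intro x
    have := congrFun (hA.mulVec_eigenvectorBasis i) x
    rw [adjMatrix_mulVec_apply, hi] at this
    simpa [neighborFinset_eq_filter] using this
  have hli : LinearIndependent ℝ (fun i : {i // hA.eigenvalues i = θ} =>
      (⟨(b i).ofLp, hmem i⟩ : G.eigenfunctions θ)) := by
    apply LinearIndependent.of_comp (Submodule.subtype _)
    have h1 : LinearIndependent ℝ (fun i : {i // hA.eigenvalues i = θ} => b i) :=
      b.orthonormal.linearIndependent.comp _ Subtype.val_injective
    exact h1.map' (WithLp.linearEquiv 2 ℝ (V → ℝ)).toLinearMap (LinearEquiv.ker _)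
  have := hli.fintype_card_le_finrank
  rwa [Fintype.card_subtype] at this

/-- Symmetry of the adjacency operator, the tool for pairing eigenfunctions with test functions. -/
theorem sum_mul_adj_comm {F : SimpleGraph V} [DecidableRel F.Adj] (f g : V → ℝ) :
    ∑ x, f x * ∑ y ∈ univ.filter (F.Adj x), g y =
      ∑ x, (∑ y ∈ univ.filter (F.Adj x), f y) * g x := by
  simp_rw [mul_sum, sum_mul, sum_filter]
  rw [sum_comm]
  refine sum_congr rfl fun x _ => sum_congr rfl fun y _ => ?_
  by_cases h : F.Adj x y
  · simp [h, h.symm]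
  · have h' : ¬ F.Adj y x := fun h' => h h'.symm
    simp [h, h']

end eigenfunctions

/-- The graph in which all edges meeting `S` are deleted. -/
def isolate {V : Type*} (G : SimpleGraph V) (S : Set V) : SimpleGraph V where
  Adj x y := G.Adj x y ∧ x ∉ S ∧ y ∉ S
  symm := ⟨fun _ _ h => ⟨h.1.symm, h.2.2, h.2.1⟩⟩
  loopless := ⟨fun _ h => h.1.ne rfl⟩

theorem isolate_adj {V : Type*} {G : SimpleGraph V} {S : Set V} {x y : V} :
    (G.isolate S).Adj x y ↔ G.Adj x y ∧ x ∉ S ∧ y ∉ S := Iff.rfl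

section parter

variable {V : Type*} [Fintype V]

/-- Isolating a vertex at which an eigenfunction vanishes, but not at some neighbour,
increases the dimension of the eigenspace. -/
theorem IsAcyclic.finrank_eigenfunctions_lt {F : SimpleGraph V} (hF : F.IsAcyclic) {θ : ℝ}
    {f : V → ℝ} (hf : f ∈ F.eigenfunctions θ) {v w : V} (hvw : F.Adj v w)
    (hv : f v = 0) (hw : f w ≠ 0) :
    Module.finrank ℝ (F.eigenfunctions θ) <
      Module.finrank ℝ ((F.isolate {v}).eigenfunctions θ) := by
  classical
  set F' := F.isolate {v} with hF'
  have adj' : ∀ x y, F'.Adj x y ↔ F.Adj x y ∧ x ≠ v ∧ y ≠ v := fun x y => by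
    simp [hF', isolate_adj]
  have hle : F' ≤ F := fun x y h => ((adj' x y).1 h).1
  let W : Set V := {x | F'.Reachable w x}
  let fW : V → ℝ := fun x => if x ∈ W then f x else 0
  have hvW : v ∉ W := by
    intro h
    obtain ⟨p⟩ : F'.Reachable v w := Reachable.symm h
    cases p with
    | nil => exact hvw.ne rfl
    | cons h _ => exact ((adj' _ _).1 h).2.1 rfl
  have hfWv : fW v = 0 := if_neg hvW
  have hclosed : ∀ x y, F.Adj x y → x ≠ v → y ∈ W → x ∈ W := by
    intro x y hxy hxv hy
    have hyv : y ≠ v := fun h => hvW (h ▸ hy)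
    exact Reachable.trans hy ((adj' y x).2 ⟨hxy.symm, hyv, hxv⟩).reachable
  have huniq : ∀ u, F.Adj v u → u ∈ W → u = w := by
    intro u hvu hu
    by_contra hne
    have hb := isBridge_iff.1 (isAcyclic_iff_forall_adj_isBridge.1 hF hvw)
    apply hb
    have h1 : (F.deleteEdges {s(v, w)}).Adj v u := by
      rw [deleteEdges_adj]
      refine ⟨hvu, fun h => ?_⟩
      simp only [Set.mem_singleton_iff, Sym2.eq_iff] at h
      rcases h with h | h
      · exact hne h.2
      · exact hvu.ne h.2.symm
    have h2 : F' ≤ F.deleteEdges {s(v, w)} := by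
      intro x y hxy
      rw [adj'] at hxy
      rw [deleteEdges_adj]
      refine ⟨hxy.1, fun h => ?_⟩
      simp only [Set.mem_singleton_iff, Sym2.eq_iff] at h
      rcases h with h | h
      · exact hxy.2.1 h.1
      · exact hxy.2.2 h.2
    exact h1.reachable.trans ((Reachable.symm hu).mono h2)
  have hsumv : ∑ y ∈ univ.filter (F.Adj v), fW y = f w := by
    rw [sum_eq_single_of_mem w (by simpa using hvw)]
    · exact if_pos (Reachable.refl w)
    · intro b hb hbw
      refine if_neg fun h => hbw (huniq b (by simpa using hb) h)
  rw [mem_eigenfunctions] at hf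
  have hsum : ∀ x, x ≠ v → ∑ y ∈ univ.filter (F.Adj x), fW y = θ * fW x := by
    intro x hx
    by_cases hxW : x ∈ W
    · have e : fW x = f x := if_pos hxW
      rw [e, ← hf]
      refine sum_congr rfl fun y hy => ?_
      simp only [mem_filter, mem_univ, true_and] at hy
      by_cases hyv : y = v
      · rw [hyv, hfWv, hv]
      · exact if_pos (hclosed y x hy.symm hyv hxW)
    · have e : fW x = 0 := if_neg hxW
      rw [e, mul_zero]
      refine sum_eq_zero fun y hy => if_neg fun h => hxW ?_
      simp only [mem_filter, mem_univ, true_and] at hy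
      exact hclosed x y hy hx h
  -- Pairing an eigenfunction g with `fW` leaves g v * f w = 0. So all eigenfunctions vanish at v
  -- and survive the isolation of v, while `fW` is a new one.
  have hvan : ∀ g ∈ F.eigenfunctions θ, g v = 0 := by
    intro g hg
    rw [mem_eigenfunctions] at hg
    have h1 := sum_mul_adj_comm (F := F) g fW
    simp_rw [hg] at h1
    have h2 : ∀ x, g x * ∑ y ∈ univ.filter (F.Adj x), fW y =
        θ * g x * fW x + if x = v then g v * f w else 0 := by
      intro x
      by_cases hx : x = v
      · rw [if_pos hx, hx, hsumv, hfWv]; ring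
      · rw [if_neg hx, hsum x hx]; ring
    simp_rw [h2] at h1
    rw [sum_add_distrib, sum_ite_eq' univ v] at h1
    simp only [mem_univ, if_true] at h1
    have : g v * f w = 0 := by linarith
    exact (mul_eq_zero.1 this).resolve_right hw
  have hsum' : ∀ (g : V → ℝ), g v = 0 → ∀ x, x ≠ v →
      ∑ y ∈ univ.filter (F'.Adj x), g y = ∑ y ∈ univ.filter (F.Adj x), g y := by
    intro g hg x hx
    apply sum_subset
    · intro y hy
      simp only [mem_filter, mem_univ, true_and] at hy ⊢
      exact hle hy
    · intro y hy hy'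
      simp only [mem_filter, mem_univ, true_and] at hy hy'
      have : y = v := by
        by_contra h
        exact hy' ((adj' _ _).2 ⟨hy, hx, h⟩)
      rw [this, hg]
  have hsumv' : ∀ g : V → ℝ, ∑ y ∈ univ.filter (F'.Adj v), g y = 0 := by
    intro g
    rw [filter_false_of_mem, sum_empty]
    intro y _ h
    exact ((adj' _ _).1 h).2.1 rfl
  apply Submodule.finrank_lt_finrank_of_lt
  rw [SetLike.lt_iff_le_and_exists]
  constructor
  · intro g hg
    have hgv := hvan g hg
    rw [mem_eigenfunctions] at hg ⊢
    intro x
    by_cases hx : x = v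
    · rw [hx, hsumv', hgv, mul_zero]
    · rw [hsum' g hgv x hx, hg]
  · refine ⟨fW, ?_, ?_⟩
    · rw [mem_eigenfunctions]
      intro x
      by_cases hx : x = v
      · rw [hx, hsumv', hfWv, mul_zero]
      · rw [hsum' fW hfWv x hx, hsum x hx]
    · intro h
      rw [mem_eigenfunctions] at h
      have := h v
      rw [hsumv, hfWv, mul_zero] at this
      exact hw this

/-- Take S of maximum size among the sets whose isolation raises the dimension by at least their
size. A zero of an eigenfunction next to a nonzero value would allow a larger set. -/
theorem IsAcyclic.exists_isolate_terminal {F : SimpleGraph V} (hF : F.IsAcyclic)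
    (θ : ℝ) : ∃ S : Finset V,
      Module.finrank ℝ (F.eigenfunctions θ) + S.card ≤
        Module.finrank ℝ ((F.isolate S).eigenfunctions θ) ∧
      ∀ f ∈ (F.isolate S).eigenfunctions θ, ∀ v w, (F.isolate S).Adj v w → f v = 0 → f w = 0 := by
  classical
  obtain ⟨S, hS, hmax⟩ := exists_max_image
    (univ.filter fun S : Finset V => Module.finrank ℝ (F.eigenfunctions θ) + S.card ≤
        Module.finrank ℝ ((F.isolate S).eigenfunctions θ)) Finset.card
    ⟨∅, by
      have : F.isolate ((∅ : Finset V) : Set V) = F := by ext; simp [isolate_adj]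
      exact mem_filter.2 ⟨mem_univ _, by rw [this, card_empty, add_zero]⟩⟩
  simp only [mem_filter, mem_univ, true_and] at hS hmax
  refine ⟨S, hS, fun f hf v w hvw hv => ?_⟩
  by_contra hw
  have hac : (F.isolate S).IsAcyclic := hF.anti fun x y h => (isolate_adj.1 h).1
  have hlt := hac.finrank_eigenfunctions_lt hf hvw hv hw
  have heq : (F.isolate S).isolate {v} = F.isolate ((insert v S : Finset V) : Set V) := by
    ext x y
    simp only [isolate_adj, coe_insert, Set.mem_insert_iff, Set.mem_singleton_iff]
    tauto
  rw [heq] at hlt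
  have hvS : v ∉ S := fun h => (isolate_adj.1 hvw).2.1 (by simpa using h)
  have := hmax (insert v S) (by rw [card_insert_of_notMem hvS]; omega)
  rw [card_insert_of_notMem hvS] at this
  omega

/-- A forest with an eigenvalue of multiplicity close to half the number of vertices is, up to a
small set of vertices, a disjoint union of single edges. -/
theorem IsAcyclic.exists_core {G : SimpleGraph V} (hG : G.IsAcyclic) {θ : ℝ} (hθ : θ ≠ 0) {t : ℕ}
    (ht : Fintype.card V ≤ 2 * Module.finrank ℝ (G.eigenfunctions θ) + t) :
    ∃ C : Finset V, C.card ≤ 3 * t ∧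
      ∀ x ∉ C, ∃ y ∉ C, G.Adj x y ∧ ∀ z, G.Adj x z → z = y ∨ z ∈ C := by
  classical
  obtain ⟨S, hS, hterm⟩ := hG.exists_isolate_terminal θ
  set F := G.isolate S with hFdef
  let K : V → Prop := fun x => ∃ y, F.Adj x y ∧ (∀ z, F.Adj x z → z = y) ∧ ∀ z, F.Adj y z → z = x
  set C := univ.filter fun x => ¬ K x with hC
  have hreach : ∀ f ∈ F.eigenfunctions θ, ∀ x y, F.Reachable x y → f x = 0 → f y = 0 := by
    intro f hf x y hxy
    obtain ⟨p⟩ := hxy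
    induction p with
    | nil => exact id
    | cons h _ ih => exact fun h0 => ih (hterm f hf _ _ h h0)
  have hnbr : ∀ f ∈ F.eigenfunctions θ, ∀ x, f x ≠ 0 → ∃ y, F.Adj x y := by
    intro f hf x hx
    by_contra hno
    push Not at hno
    rw [mem_eigenfunctions] at hf
    have := hf x
    rw [filter_false_of_mem (fun y _ => hno y), sum_empty] at this
    exact mul_ne_zero hθ hx this.symm
  set 𝒞 := univ.filter fun c : F.ConnectedComponent =>
    ∃ f ∈ F.eigenfunctions θ, f c.out ≠ 0 with h𝒞
  -- An eigenfunction vanishes on a component everywhere or nowhere, so one evaluation point per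
  -- component determines it.
  have hrank : Module.finrank ℝ (F.eigenfunctions θ) ≤ 𝒞.card := by
    let φ : F.eigenfunctions θ →ₗ[ℝ] (𝒞 → ℝ) :=
      { toFun := fun f c => f.1 c.1.out
        map_add' := fun _ _ => rfl
        map_smul' := fun _ _ => rfl }
    have hinj : Function.Injective φ := by
      rw [← LinearMap.ker_eq_bot, LinearMap.ker_eq_bot']
      intro f hf
      ext x
      have hx : F.Reachable (F.connectedComponentMk x).out x :=
        ConnectedComponent.exact (Quot.out_eq _)
      apply hreach f.1 f.2 _ _ hx
      by_contra hne
      have hmem : F.connectedComponentMk x ∈ 𝒞 := by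
        simp only [h𝒞, mem_filter, mem_univ, true_and]
        exact ⟨f.1, f.2, hne⟩
      exact hne (congrFun hf ⟨_, hmem⟩)
    have := LinearMap.finrank_le_finrank_of_injective hinj
    simpa using this
  -- A component carrying an eigenfunction has at least two vertices, as θ ≠ 0. With exactly two it
  -- is a single edge and misses C; with m ≥ 3 vertices, 6 + m ≤ 3m. Summation gives 6 dim + |C| ≤
  -- 3n ≤ 6 dim + 3t.
  have hfib : ∀ c : F.ConnectedComponent, 6 * (if c ∈ 𝒞 then 1 else 0) +
      (C.filter fun x => F.connectedComponentMk x = c).card ≤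
        3 * (univ.filter fun x => F.connectedComponentMk x = c).card := by
    intro c
    have hsub : C.filter (fun x => F.connectedComponentMk x = c) ⊆
        univ.filter fun x => F.connectedComponentMk x = c :=
      filter_subset_filter _ (subset_univ _)
    have hcard := card_le_card hsub
    split_ifs with hc
    · simp only [h𝒞, mem_filter, mem_univ, true_and] at hc
      obtain ⟨f, hf, hfc⟩ := hc
      have hne : ∀ x, F.connectedComponentMk x = c → f x ≠ 0 := by
        intro x hx h0
        apply hfc
        apply hreach f hf x _ _ h0
        apply ConnectedComponent.exact
        rw [hx]
        exact (Quot.out_eq c).symm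
      have hadjc : ∀ x y, F.Adj x y → F.connectedComponentMk x = c →
          F.connectedComponentMk y = c := by
        intro x y hxy hx
        rw [← hx]
        exact ConnectedComponent.sound hxy.symm.reachable
      by_cases hemp : (C.filter fun x => F.connectedComponentMk x = c) = ∅
      · rw [hemp, card_empty]
        have h0 : F.connectedComponentMk c.out = c := Quot.out_eq c
        obtain ⟨y, hy⟩ := hnbr f hf _ (hne _ h0)
        have : ({c.out, y} : Finset V) ⊆ univ.filter fun x => F.connectedComponentMk x = c := by
          intro x hx
          simp only [mem_insert, mem_singleton] at hx
          simp only [mem_filter, mem_univ, true_and]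
          rcases hx with rfl | rfl
          · exact h0
          · exact hadjc _ _ hy h0
        have := card_le_card this
        rw [card_pair hy.ne] at this
        omega
      · obtain ⟨x, hx⟩ := nonempty_iff_ne_empty.2 hemp
        simp only [mem_filter, hC, mem_univ, true_and] at hx
        obtain ⟨hxK, hxc⟩ := hx
        obtain ⟨y, hy⟩ := hnbr f hf _ (hne _ hxc)
        have hyc := hadjc _ _ hy hxc
        have : ∃ z, z ≠ x ∧ z ≠ y ∧ F.connectedComponentMk z = c := by
          by_contra hcon
          push Not at hcon
          apply hxK
          refine ⟨y, hy, fun z hz => ?_, fun z hz => ?_⟩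
          · by_contra hzy
            exact hcon z hz.ne' hzy (hadjc _ _ hz hxc)
          · by_contra hzx
            exact hcon z hzx hz.ne' (hadjc _ _ hz hyc)
        obtain ⟨z, hzx, hzy, hzc⟩ := this
        have : ({x, y, z} : Finset V) ⊆ univ.filter fun x => F.connectedComponentMk x = c := by
          intro u hu
          simp only [mem_insert, mem_singleton] at hu
          simp only [mem_filter, mem_univ, true_and]
          rcases hu with rfl | rfl | rfl <;> assumption
        have := card_le_card this
        rw [card_eq_three.2 ⟨x, y, z, hy.ne, hzx.symm, hzy.symm, rfl⟩] at this
        omega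
    · omega
  have hsum := sum_le_sum (s := univ) fun c _ => hfib c
  have hC1 : C.card = ∑ c, (C.filter fun x => F.connectedComponentMk x = c).card :=
    card_eq_sum_card_fiberwise fun _ _ => mem_univ _
  have hV1 : (univ : Finset V).card =
      ∑ c, (univ.filter fun x => F.connectedComponentMk x = c).card :=
    card_eq_sum_card_fiberwise fun _ _ => mem_univ _
  rw [sum_add_distrib, ← mul_sum, ← mul_sum, sum_boole, ← hC1, ← hV1, card_univ,
    filter_mem_eq_inter, univ_inter] at hsum
  refine ⟨C, ?_, fun x hx => ?_⟩
  · simp only [Nat.cast_id] at hsum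
    omega
  · simp only [hC, mem_filter, mem_univ, true_and, not_not] at hx
    obtain ⟨y, hxy, h1, h2⟩ := hx
    refine ⟨y, ?_, (isolate_adj.1 hxy).1, fun z hz => ?_⟩
    · simp only [hC, mem_filter, mem_univ, true_and, not_not]
      exact ⟨x, hxy.symm, h2, h1⟩
    · by_cases hzS : z ∈ S
      · right
        simp only [hC, mem_filter, mem_univ, true_and]
        rintro ⟨u, hu, -⟩
        exact (isolate_adj.1 hu).2.1 (by simpa using hzS)
      · left
        exact h1 z (isolate_adj.2 ⟨hz, (isolate_adj.1 hxy).2.1, by simpa using hzS⟩)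

end parter

end SimpleGraph

/-! ### Arms and hubs -/

namespace SimpleGraph

open Finset

/-- `y` has exactly the neighbours `v` and `l`, and `l` is a leaf. -/
structure IsArm {V : Type*} (G : SimpleGraph V) (y l v : V) : Prop where
  ne : v ≠ l
  adj_mid : ∀ z, G.Adj y z ↔ z = v ∨ z = l
  adj_leaf : ∀ z, G.Adj l z ↔ z = y

/-- Let W be the complement of C, matched by p, and a the number of edges between W and C. The
degree sum of a tree gives 2a ≤ |W| + 2|C| - 2. Let D x count the edges from the pair {x, p x} to C;
by connectedness D ≥ 1, and D sums to 2a over W. Hence fewer than 2|C| vertices have D ≥ 2, and the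
pairs with D = 1 are arms. -/
theorem IsTree.exists_arms {V : Type*} [Fintype V] {G : SimpleGraph V} (hG : G.IsTree)
    (hV : 2 < Fintype.card V) {C : Finset V}
    (hC : ∀ x ∉ C, ∃ y ∉ C, G.Adj x y ∧ ∀ z, G.Adj x z → z = y ∨ z ∈ C) :
    ∃ C' : Finset V, C'.card ≤ 3 * C.card ∧
      ∀ x ∉ C', ∃ y ∉ C', ∃ v ∈ C', G.IsArm x y v ∨ G.IsArm y x v := by
  classical
  have hC' : ∀ x, ∃ y, x ∉ C → y ∉ C ∧ G.Adj x y ∧ ∀ z, G.Adj x z → z = y ∨ z ∈ C := by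
    intro x
    by_cases hx : x ∈ C
    · exact ⟨x, fun h => absurd hx h⟩
    · obtain ⟨y, h1, h2, h3⟩ := hC x hx
      exact ⟨y, fun _ => ⟨h1, h2, h3⟩⟩
  choose p hp using hC'
  have hpp : ∀ x ∉ C, p (p x) = x := by
    intro x hx
    obtain ⟨h1, h2, -⟩ := hp x hx
    rcases (hp _ h1).2.2 x h2.symm with h | h
    · exact h.symm
    · exact absurd h hx
  set W := univ \ C with hW
  have memW : ∀ x, x ∈ W ↔ x ∉ C := by simp [hW]
  let d : V → ℕ := fun x => (C.filter fun z => G.Adj x z).card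
  let D : V → ℕ := fun x => d x + d (p x)
  have hdeg : ∀ x ∈ W, G.degree x = 1 + d x := by
    intro x hx
    rw [memW] at hx
    obtain ⟨h1, h2, h3⟩ := hp x hx
    have : G.neighborFinset x = insert (p x) (C.filter fun z => G.Adj x z) := by
      ext z
      simp only [mem_neighborFinset, mem_insert, mem_filter]
      constructor
      · intro hz
        rcases h3 z hz with h | h
        · exact Or.inl h
        · exact Or.inr ⟨h, hz⟩
      · rintro (rfl | h)
        · exact h2
        · exact h.2
    rw [← card_neighborFinset_eq_degree, this, card_insert_of_notMem (by simp [h1]), add_comm]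
  have hdegC : ∀ v ∈ C, (W.filter fun x => G.Adj x v).card ≤ G.degree v := by
    intro v _
    rw [← card_neighborFinset_eq_degree]
    apply card_le_card
    intro x hx
    simpa using (mem_filter.1 hx).2.symm
  have hdouble : ∑ v ∈ C, (W.filter fun x => G.Adj x v).card = ∑ x ∈ W, d x := by
    simp_rw [d, card_filter]
    rw [sum_comm]
  have hsumdeg : ∑ x, G.degree x = ∑ x ∈ W, G.degree x + ∑ x ∈ C, G.degree x := by
    rw [hW, sum_sdiff (subset_univ C)]
  have hedge := hG.card_edgeFinset
  have htw := G.sum_degrees_eq_twice_card_edges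
  have h1 : ∑ x ∈ W, G.degree x = W.card + ∑ x ∈ W, d x := by
    rw [sum_congr rfl hdeg, sum_add_distrib]; simp
  have h2 := sum_le_sum hdegC
  have hWC : W.card + C.card = Fintype.card V := by
    rw [hW, card_sdiff_add_card_eq_card (subset_univ C), card_univ]
  have hpW : ∑ x ∈ W, d (p x) = ∑ x ∈ W, d x := by
    refine sum_nbij' p p ?_ ?_ ?_ ?_ ?_
    · intro x hx; rw [memW] at hx ⊢; exact (hp x hx).1
    · intro x hx; rw [memW] at hx ⊢; exact (hp x hx).1
    · intro x hx; exact hpp x ((memW x).1 hx)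
    · intro x hx; exact hpp x ((memW x).1 hx)
    · intro x _; rfl
  have hDsum : ∑ x ∈ W, D x = 2 * ∑ x ∈ W, d x := by
    simp only [D]
    rw [sum_add_distrib, hpW]; ring
  have hDpos : ∀ x ∉ C, 1 ≤ D x := by
    intro x hx
    by_contra hlt
    have hD0 : D x = 0 := by omega
    have hd1 : d x = 0 := by simp only [D] at hD0; omega
    have hd2 : d (p x) = 0 := by simp only [D] at hD0; omega
    have hno : ∀ u, d u = 0 → ∀ z ∈ C, ¬ G.Adj u z := by
      intro u hu z hz hadj
      simp only [d, card_eq_zero] at hu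
      have : z ∈ C.filter fun z => G.Adj u z := mem_filter.2 ⟨hz, hadj⟩
      rw [hu] at this
      simp at this
    have hall : ∀ z, z = x ∨ z = p x := by
      intro z
      obtain ⟨q⟩ := hG.1.preconnected x z
      have : ∀ a b, G.Walk a b → (a = x ∨ a = p x) → (b = x ∨ b = p x) := by
        intro a b q
        induction q with
        | nil => exact id
        | cons h _ ih =>
          intro ha
          apply ih
          rcases ha with rfl | rfl
          · rcases (hp _ hx).2.2 _ h with h' | h'
            · exact Or.inr h'
            · exact absurd h (hno _ hd1 _ h')
          · rcases (hp _ (hp x hx).1).2.2 _ h with h' | h'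
            · left; rw [h', hpp x hx]
            · exact absurd h (hno _ hd2 _ h')
      exact this x z q (Or.inl rfl)
    have : (univ : Finset V) ⊆ {x, p x} := by
      intro z _
      simpa using hall z
    have := card_le_card this
    rw [card_univ] at this
    have := card_le_two (a := x) (b := p x)
    omega
  set B := W.filter fun x => 2 ≤ D x with hB
  have hBcard : W.card + B.card ≤ ∑ x ∈ W, D x := by
    rw [card_eq_sum_ones, hB, card_filter, ← sum_add_distrib]
    apply sum_le_sum
    intro x hx
    have := hDpos x ((memW x).1 hx)
    split_ifs <;> omega
  refine ⟨C ∪ B, ?_, ?_⟩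
  · have := card_union_le C B
    omega
  · intro x hx
    have memCB : ∀ x, x ∉ C ∪ B ↔ x ∉ C ∧ D x = 1 := by
      intro x
      rw [mem_union, not_or, hB, mem_filter, memW]
      constructor
      · rintro ⟨h1, h2⟩
        have := hDpos x h1
        exact ⟨h1, by by_contra h; exact h2 ⟨h1, by omega⟩⟩
      · rintro ⟨h1, h2⟩
        exact ⟨h1, fun h => by omega⟩
    rw [memCB] at hx
    obtain ⟨hxC, hD1⟩ := hx
    obtain ⟨hpC, hadj, hnb⟩ := hp x hxC
    have key : ∀ a, a ∉ C → d a = 1 → d (p a) = 0 → ∃ v ∈ C, G.IsArm a (p a) v := by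
      intro a ha h1 h0
      obtain ⟨v, hv⟩ := card_eq_one.1 h1
      have hv' : ∀ z, (z ∈ C ∧ G.Adj a z) ↔ z = v := by
        intro z
        rw [← mem_filter (p := fun z => G.Adj a z), hv, mem_singleton]
      obtain ⟨hvC, hav⟩ := (hv' v).2 rfl
      obtain ⟨hpa, hpadj, hpn⟩ := hp a ha
      refine ⟨v, hvC, fun h => hpa (h ▸ hvC), fun z => ⟨fun hz => ?_, ?_⟩, fun z => ⟨fun hz => ?_, ?_⟩⟩
      · rcases hpn z hz with h | h
        · exact Or.inr h
        · exact Or.inl ((hv' z).1 ⟨h, hz⟩)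
      · rintro (rfl | rfl)
        · exact hav
        · exact hpadj
      · rcases (hp _ hpa).2.2 z hz with h | h
        · rw [h, hpp a ha]
        · exfalso
          simp only [d, card_eq_zero] at h0
          have : z ∈ C.filter fun z => G.Adj (p a) z := mem_filter.2 ⟨h, hz⟩
          rw [h0] at this
          simp at this
      · rintro rfl
        exact hpadj.symm
    refine ⟨p x, (memCB _).2 ⟨hpC, ?_⟩, ?_⟩
    · simp only [D] at hD1 ⊢
      rw [hpp x hxC]; omega
    · simp only [D] at hD1
      rcases Nat.eq_zero_or_pos (d x) with h0 | hpos
      · obtain ⟨v, hv, harm⟩ := key (p x) hpC (by omega) (by rw [hpp x hxC]; exact h0)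
        rw [hpp x hxC] at harm
        exact ⟨v, mem_union_left _ hv, Or.inr harm⟩
      · obtain ⟨v, hv, harm⟩ := key x hxC (by omega) (by omega)
        exact ⟨v, mem_union_left _ hv, Or.inl harm⟩

end SimpleGraph

/-- Finitely many numbers avoid one of the windows `[L, Φ L)`. -/
theorem Finset.exists_gap (Φ : ℕ → ℕ) (K L₀ : ℕ) :
    ∃ M, ∀ {α : Type*} (S : Finset α) (N : α → ℕ), S.card ≤ K →
      ∃ L, L₀ ≤ L ∧ L ≤ M ∧ ∀ v ∈ S, N v < L ∨ Φ L ≤ N v := by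
  classical
  induction K generalizing L₀ with
  | zero =>
    refine ⟨L₀, fun S N hS => ⟨L₀, le_rfl, le_rfl, ?_⟩⟩
    rw [Nat.le_zero, Finset.card_eq_zero] at hS
    simp [hS]
  | succ K ih =>
    -- If the window at L₀ catches some v, all windows starting at Φ L₀ or later lie above N v, so v
    -- can be discarded.
    obtain ⟨M, hM⟩ := ih (max (Φ L₀) L₀)
    refine ⟨max M L₀, fun S N hS => ?_⟩
    by_cases h : ∀ v ∈ S, N v < L₀ ∨ Φ L₀ ≤ N v
    · exact ⟨L₀, le_rfl, le_max_right _ _, h⟩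
    · push Not at h
      obtain ⟨v, hv, h1, h2⟩ := h
      obtain ⟨L, hL1, hL2, hL3⟩ := hM (S.erase v) N (by rw [Finset.card_erase_of_mem hv]; omega)
      refine ⟨L, le_trans (le_max_right _ _) hL1, hL2.trans (le_max_left _ _), fun w hw => ?_⟩
      by_cases hwv : w = v
      · left
        rw [hwv]
        exact lt_of_lt_of_le h2 (le_trans (le_max_left _ _) hL1)
      · exact hL3 w (Finset.mem_erase.2 ⟨hwv, hw⟩)

namespace SimpleGraph

open Finset

/-- A decomposition of the vertices into a set `H` of hubs, each carrying at least `N` arms with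
mid vertices in `Y` and leaves `lf y`, and a remainder `Q`. -/
structure IsHubDecomposition {V : Type*} [DecidableEq V] (G : SimpleGraph V) (H Q Y : Finset V)
    (hub lf : V → V) (K b N : ℕ) : Prop where
  card_hubs : H.card ≤ K
  card_rest : Q.card ≤ b
  disjoint : ∀ x ∈ H, x ∉ Q
  hub_mem : ∀ y ∈ Y, hub y ∈ H
  isArm : ∀ y ∈ Y, G.IsArm y (lf y) (hub y)
  mid_notMem : ∀ y ∈ Y, y ∉ H ∧ y ∉ Q
  leaf_notMem : ∀ y ∈ Y, lf y ∉ H ∧ lf y ∉ Q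
  cover : ∀ x, x ∈ H ∨ x ∈ Q ∨ x ∈ Y ∨ ∃ y ∈ Y, x = lf y
  le_card_arms : ∀ v ∈ H, N ≤ (Y.filter fun y => hub y = v).card

/-- No vertex of C has a number of arms in the window from L to Φ L. Those above it become hubs; the
others, with at most L arms of two vertices each, form the remainder, whence the bound K (1 + 2 L).
As Φ is arbitrary, hubs can be made large relative to this bound. -/
theorem exists_isHubDecomposition {V : Type*} [Fintype V] [DecidableEq V] {G : SimpleGraph V}
    {K : ℕ} {C : Finset V} (hCK : C.card ≤ K)
    (hC : ∀ x ∉ C, ∃ y ∉ C, ∃ v ∈ C, G.IsArm x y v ∨ G.IsArm y x v) {Φ : ℕ → ℕ} {M : ℕ}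
    (hM : ∀ (S : Finset V) (N : V → ℕ), S.card ≤ K →
      ∃ L, 0 ≤ L ∧ L ≤ M ∧ ∀ v ∈ S, N v < L ∨ Φ L ≤ N v)
    (hV : K * (1 + 2 * M) < Fintype.card V) :
    ∃ L H Q Y hub lf, H.Nonempty ∧
      G.IsHubDecomposition H Q Y hub lf K (K * (1 + 2 * L)) (Φ L) := by
  classical
  let A : V → V → Prop := fun v y => y ∉ C ∧ ∃ l, l ∉ C ∧ G.IsArm y l v
  let N : V → ℕ := fun v => (univ.filter (A v)).card
  obtain ⟨L, -, hLM, hL⟩ := hM C N hCK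
  set H := C.filter fun v => Φ L ≤ N v with hH
  set Y := univ.filter fun y => ∃ v ∈ H, A v y with hY
  have hY' : ∀ y, ∃ v l, y ∈ Y → v ∈ H ∧ y ∉ C ∧ l ∉ C ∧ G.IsArm y l v := by
    intro y
    by_cases hy : y ∈ Y
    · obtain ⟨v, hv, h1, l, h2, h3⟩ := (mem_filter.1 hy).2
      exact ⟨v, l, fun _ => ⟨hv, h1, h2, h3⟩⟩
    · exact ⟨y, y, fun h => absurd h hy⟩
  choose hub lf hyl using hY'
  have leaf_unique : ∀ y l l' v v', l ∉ C → l' ∉ C → v ∈ C → v' ∈ C → G.IsArm y l v →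
      G.IsArm y l' v' → v = v' ∧ l = l' := by
    intro y l l' v v' hl hl' hv hv' h h'
    constructor
    · rcases (h'.adj_mid v).1 ((h.adj_mid v).2 (Or.inl rfl)) with e | e
      · exact e
      · exact absurd (e ▸ hv) hl'
    · rcases (h'.adj_mid l).1 ((h.adj_mid l).2 (Or.inr rfl)) with e | e
      · exact absurd (e ▸ hv') hl
      · exact e
  set Q := univ.filter fun x => x ∉ H ∧ x ∉ Y ∧ ∀ y ∈ Y, x ≠ lf y with hQ
  have hHC : ∀ v ∈ H, v ∈ C := fun v hv => (mem_filter.1 hv).1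
  have hQsub : Q ⊆ (C \ H) ∪ (C \ H).biUnion (fun v => univ.filter (A v)) ∪
      (C \ H).biUnion (fun v => univ.filter fun x => x ∉ C ∧ ∃ y, y ∉ C ∧ G.IsArm y x v) := by
    intro x hx
    obtain ⟨hxH, hxY, hxl⟩ := (mem_filter.1 hx).2
    by_cases hxC : x ∈ C
    · exact mem_union_left _ (mem_union_left _ (mem_sdiff.2 ⟨hxC, hxH⟩))
    obtain ⟨y, hy, v, hv, h | h⟩ := hC x hxC
    · apply mem_union_left
      apply mem_union_right
      have hvH : v ∉ H := fun hvH => hxY (mem_filter.2 ⟨mem_univ _, v, hvH, hxC, y, hy, h⟩)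
      exact mem_biUnion.2 ⟨v, mem_sdiff.2 ⟨hv, hvH⟩, mem_filter.2 ⟨mem_univ _, hxC, y, hy, h⟩⟩
    · apply mem_union_right
      have hvH : v ∉ H := by
        intro hvH
        have hyY : y ∈ Y := mem_filter.2 ⟨mem_univ _, v, hvH, hy, x, hxC, h⟩
        obtain ⟨h1, h2, h3, h4⟩ := hyl y hyY
        exact hxl y hyY (leaf_unique y x (lf y) v (hub y) hxC h3 hv (hHC _ h1) h h4).2
      exact mem_biUnion.2 ⟨v, mem_sdiff.2 ⟨hv, hvH⟩, mem_filter.2 ⟨mem_univ _, hxC, y, hy, h⟩⟩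
  have hsmall : ∀ v ∈ C \ H, N v ≤ L := by
    intro v hv
    rw [mem_sdiff] at hv
    rcases hL v hv.1 with h | h
    · exact h.le
    · exact absurd (mem_filter.2 ⟨hv.1, h⟩) hv.2
  have hleaf : ∀ v, (univ.filter fun x => x ∉ C ∧ ∃ y, y ∉ C ∧ G.IsArm y x v).card ≤ N v := by
    intro v
    apply card_le_card_of_forall_subsingleton (fun x y => G.IsArm y x v)
    · intro x hx
      obtain ⟨hxC, y, hy, h⟩ := (mem_filter.1 hx).2
      exact ⟨y, mem_filter.2 ⟨mem_univ _, hy, x, hxC, h⟩, h⟩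
    · intro y _ x hx x' hx'
      obtain ⟨-, h⟩ := hx
      obtain ⟨-, h'⟩ := hx'
      rcases (h'.adj_mid x).1 ((h.adj_mid x).2 (Or.inr rfl)) with e | e
      · exact absurd e.symm h.ne
      · exact e
  have hcard : (C \ H).card ≤ K := (card_le_card sdiff_subset).trans hCK
  have hQcard : Q.card ≤ K * (1 + 2 * L) := by
    refine (card_le_card hQsub).trans ?_
    refine (card_union_le _ _).trans ?_
    have e1 := card_union_le (C \ H) ((C \ H).biUnion fun v => univ.filter (A v))
    have e2 : ((C \ H).biUnion fun v => univ.filter (A v)).card ≤ (C \ H).card * L :=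
      card_biUnion_le_card_mul _ _ _ fun v hv => hsmall v hv
    have e3 : ((C \ H).biUnion (fun v => univ.filter fun x => x ∉ C ∧ ∃ y, y ∉ C ∧
        G.IsArm y x v)).card ≤ (C \ H).card * L :=
      card_biUnion_le_card_mul _ _ _ fun v hv => (hleaf v).trans (hsmall v hv)
    have e4 : (C \ H).card * L ≤ K * L := Nat.mul_le_mul_right _ hcard
    have e5 : K * (1 + 2 * L) = K + K * L + K * L := by ring
    omega
  refine ⟨L, H, Q, Y, hub, lf, ?_, ?_⟩
  -- Without hubs the remainder would be the whole vertex set, which is too large.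
  · by_contra hne
    rw [not_nonempty_iff_eq_empty] at hne
    have hYe : Y = ∅ := by
      rw [hY, filter_eq_empty_iff]
      rintro y - ⟨v, hv, -⟩
      rw [hne] at hv
      simp at hv
    have hQu : Q = univ := by
      ext x
      simp [hQ, hne, hYe]
    rw [hQu, card_univ] at hQcard
    have : K * (1 + 2 * L) ≤ K * (1 + 2 * M) := by gcongr
    omega
  · refine ⟨(card_le_card (filter_subset _ _)).trans hCK, hQcard, ?_, ?_, ?_, ?_, ?_, ?_, ?_⟩
    · intro x hx hx'
      exact (mem_filter.1 hx').2.1 hx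
    · exact fun y hy => (hyl y hy).1
    · exact fun y hy => (hyl y hy).2.2.2
    · intro y hy
      exact ⟨fun h => (hyl y hy).2.1 (hHC _ h), fun h => (mem_filter.1 h).2.2.1 hy⟩
    · intro y hy
      exact ⟨fun h => (hyl y hy).2.2.1 (hHC _ h), fun h => (mem_filter.1 h).2.2.2 y hy rfl⟩
    · intro x
      by_contra hx
      push Not at hx
      exact hx.2.1 (mem_filter.2 ⟨mem_univ _, hx.1, hx.2.2.1, hx.2.2.2⟩)
    · intro v hv
      refine (mem_filter.1 hv).2.trans (card_le_card fun y hy => ?_)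
      have hA := (mem_filter.1 hy).2
      have hyY : y ∈ Y := mem_filter.2 ⟨mem_univ _, v, hv, hA⟩
      refine mem_filter.2 ⟨hyY, ?_⟩
      obtain ⟨h0, l, h1, h2⟩ := hA
      obtain ⟨h3, h4, h5, h6⟩ := hyl y hyY
      exact (leaf_unique y (lf y) l (hub y) v h5 h1 (hHC _ h3) (hHC _ hv) h6 h2).1

end SimpleGraph

/-! ### Approximate eigenvectors and uniform Perron vectors -/

section

open Finset

namespace Matrix.IsHermitian

variable {n : Type*} [Fintype n] [DecidableEq n] {A : Matrix n n ℝ}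

theorem eigenvector_dotProduct_mulVec (hA : A.IsHermitian) (i : n) (x : n → ℝ) :
    (hA.eigenvectorBasis i).ofLp ⬝ᵥ (A *ᵥ x) =
      hA.eigenvalues i * ((hA.eigenvectorBasis i).ofLp ⬝ᵥ x) := by
  have hs : Aᵀ = A := by
    rw [← Matrix.conjTranspose_eq_transpose_of_trivial]; exact hA
  rw [Matrix.dotProduct_mulVec, ← Matrix.mulVec_transpose, hs, hA.mulVec_eigenvectorBasis,
    smul_dotProduct, smul_eq_mul]

theorem sum_sq_eigenvector_dotProduct (hA : A.IsHermitian) (x : n → ℝ) :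
    ∑ i, ((hA.eigenvectorBasis i).ofLp ⬝ᵥ x) ^ 2 = ∑ j, x j ^ 2 := by
  have h := hA.eigenvectorBasis.sum_sq_norm_inner_right (WithLp.toLp 2 x)
  rw [EuclideanSpace.norm_sq_eq] at h
  simp only [Real.norm_eq_abs, sq_abs] at h
  rw [← h]
  refine sum_congr rfl fun i _ => ?_
  congr 1
  rw [EuclideanSpace.inner_eq_star_dotProduct, dotProduct_comm]
  simp

theorem eigenvector_dotProduct_eigenvector (hA : A.IsHermitian) (i j : n) :
    (hA.eigenvectorBasis i).ofLp ⬝ᵥ (hA.eigenvectorBasis j).ofLp = if i = j then 1 else 0 := by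
  have h := orthonormal_iff_ite.1 hA.eigenvectorBasis.orthonormal i j
  rw [EuclideanSpace.inner_eq_star_dotProduct, dotProduct_comm] at h
  simpa using h

/-- An approximate eigenvector is close to an eigenvector if the spectrum has a gap. -/
theorem exists_eigenvector_near (hA : A.IsHermitian) {τ δ : ℝ} (hδ : 0 ≤ δ)
    (hgap : ∀ i, hA.eigenvalues i ≠ τ → δ ≤ |hA.eigenvalues i - τ|) (x : n → ℝ) :
    ∃ z, A *ᵥ z = τ • z ∧
      δ ^ 2 * ∑ i, (x i - z i) ^ 2 ≤ ∑ i, ((A *ᵥ x) i - τ * x i) ^ 2 := by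
  let u : n → n → ℝ := fun i => (hA.eigenvectorBasis i).ofLp
  let S := univ.filter fun i => hA.eigenvalues i = τ
  -- The orthogonal projection of x to the τ-eigenspace; it is 0 if τ is not an eigenvalue.
  let z : n → ℝ := ∑ i ∈ S, (u i ⬝ᵥ x) • u i
  have hz : ∀ k, u k ⬝ᵥ z = if hA.eigenvalues k = τ then u k ⬝ᵥ x else 0 := by
    intro k
    simp only [z, dotProduct_sum, dotProduct_smul, smul_eq_mul]
    have : ∀ i, u k ⬝ᵥ u i = if k = i then 1 else 0 :=
      hA.eigenvector_dotProduct_eigenvector k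
    simp only [this, mul_ite, mul_one, mul_zero, sum_ite_eq, S, mem_filter, mem_univ, true_and]
  refine ⟨z, ?_, ?_⟩
  · simp only [z, Matrix.mulVec_sum, Matrix.mulVec_smul, smul_sum]
    refine sum_congr rfl fun i hi => ?_
    have h1 : A *ᵥ u i = hA.eigenvalues i • u i := hA.mulVec_eigenvectorBasis i
    rw [h1, (mem_filter.1 hi).2, smul_comm]
  · have e1 := hA.sum_sq_eigenvector_dotProduct (x - z)
    have e2 := hA.sum_sq_eigenvector_dotProduct (A *ᵥ x - τ • x)
    simp only [Pi.sub_apply, Pi.smul_apply, smul_eq_mul] at e1 e2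
    rw [← e1, ← e2, mul_sum]
    refine sum_le_sum fun k _ => ?_
    rw [dotProduct_sub, dotProduct_sub, hA.eigenvector_dotProduct_mulVec, dotProduct_smul,
      smul_eq_mul, ← sub_mul, mul_pow]
    have hzk : (hA.eigenvectorBasis k).ofLp ⬝ᵥ z = _ := hz k
    rw [hzk]
    split_ifs with h
    · rw [sub_self]; simp only [ne_eq, OfNat.ofNat_ne_zero, not_false_eq_true, zero_pow, mul_zero]
      positivity
    · rw [sub_zero]
      have := hgap k h
      have h2 : δ ^ 2 ≤ (hA.eigenvalues k - τ) ^ 2 := by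
        rw [← sq_abs (hA.eigenvalues k - τ)]
        gcongr
      exact mul_le_mul_of_nonneg_right h2 (sq_nonneg _)

/-- A symmetric matrix with nonnegative entries has a nonnegative eigenvector. -/
theorem exists_nonneg_eigenvector [Nonempty n] (hA : A.IsHermitian) (hpos : ∀ i j, 0 ≤ A i j) :
    ∃ (f : n → ℝ) (τ : ℝ), (∀ i, 0 ≤ f i) ∧ f ≠ 0 ∧ A *ᵥ f = τ • f := by
  obtain ⟨k, hk⟩ := Finite.exists_max hA.eigenvalues
  let u : n → ℝ := (hA.eigenvectorBasis k).ofLp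
  -- Taking absolute values of a top eigenvector does not lower the quadratic form, so f attains the
  -- maximum and lies in the top eigenspace.
  let f : n → ℝ := fun i => |u i|
  have huu : u ⬝ᵥ u = 1 := by
    have := hA.eigenvector_dotProduct_eigenvector k k
    rwa [if_pos rfl] at this
  have hff : ∑ j, f j ^ 2 = 1 := by
    rw [← huu]
    simp only [dotProduct, f, sq_abs]
    exact sum_congr rfl fun i _ => pow_two _
  have hAu : A *ᵥ u = hA.eigenvalues k • u := hA.mulVec_eigenvectorBasis k
  have hform : hA.eigenvalues k ≤ f ⬝ᵥ (A *ᵥ f) := by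
    have : hA.eigenvalues k = u ⬝ᵥ (A *ᵥ u) := by
      rw [hAu, dotProduct_smul, huu]; simp
    rw [this]
    simp only [dotProduct, mulVec, mul_sum]
    refine sum_le_sum fun i _ => sum_le_sum fun j _ => ?_
    calc u i * (A i j * u j) ≤ |u i * (A i j * u j)| := le_abs_self _
      _ = |u i| * (A i j * |u j|) := by rw [abs_mul, abs_mul, abs_of_nonneg (hpos i j)]
  -- Polarization: Parseval for f + A f and for f - A f.
  have hexp : f ⬝ᵥ (A *ᵥ f) =
      ∑ i, hA.eigenvalues i * ((hA.eigenvectorBasis i).ofLp ⬝ᵥ f) ^ 2 := by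
    have e1 := hA.sum_sq_eigenvector_dotProduct (f + A *ᵥ f)
    have e2 := hA.sum_sq_eigenvector_dotProduct (f - A *ᵥ f)
    have l1 : ∑ j, (f + A *ᵥ f) j ^ 2 - ∑ j, (f - A *ᵥ f) j ^ 2 = 4 * (f ⬝ᵥ (A *ᵥ f)) := by
      rw [← sum_sub_distrib, dotProduct, mul_sum]
      refine sum_congr rfl fun i _ => ?_
      simp only [Pi.add_apply, Pi.sub_apply]; ring
    rw [← e1, ← e2, ← sum_sub_distrib] at l1
    have : ∀ i, ((hA.eigenvectorBasis i).ofLp ⬝ᵥ (f + A *ᵥ f)) ^ 2 -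
        ((hA.eigenvectorBasis i).ofLp ⬝ᵥ (f - A *ᵥ f)) ^ 2 =
        4 * (hA.eigenvalues i * ((hA.eigenvectorBasis i).ofLp ⬝ᵥ f) ^ 2) := by
      intro i
      rw [dotProduct_add, dotProduct_sub, hA.eigenvector_dotProduct_mulVec]; ring
    rw [sum_congr rfl fun i _ => this i, ← mul_sum] at l1
    linarith
  have hpars := hA.sum_sq_eigenvector_dotProduct f
  rw [hff] at hpars
  have hzero : ∀ i, (hA.eigenvalues k - hA.eigenvalues i) *
      ((hA.eigenvectorBasis i).ofLp ⬝ᵥ f) ^ 2 = 0 := by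
    have hnn : ∀ i ∈ univ, 0 ≤ (hA.eigenvalues k - hA.eigenvalues i) *
      ((hA.eigenvectorBasis i).ofLp ⬝ᵥ f) ^ 2 := fun i _ =>
        mul_nonneg (sub_nonneg.2 (hk i)) (sq_nonneg _)
    have hs : ∑ i, (hA.eigenvalues k - hA.eigenvalues i) *
      ((hA.eigenvectorBasis i).ofLp ⬝ᵥ f) ^ 2 = 0 := by
      apply le_antisymm _ (sum_nonneg hnn)
      simp_rw [sub_mul]
      rw [sum_sub_distrib, ← mul_sum, hpars, ← hexp]
      linarith
    intro i
    exact (sum_eq_zero_iff_of_nonneg hnn).1 hs i (mem_univ i)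
  refine ⟨f, hA.eigenvalues k, fun i => abs_nonneg _, ?_, ?_⟩
  · intro h
    rw [h] at hff
    simp at hff
  · have e := hA.sum_sq_eigenvector_dotProduct (A *ᵥ f - hA.eigenvalues k • f)
    have hz : ∑ i, ((hA.eigenvectorBasis i).ofLp ⬝ᵥ (A *ᵥ f - hA.eigenvalues k • f)) ^ 2 = 0 := by
      refine sum_eq_zero fun i _ => ?_
      rw [dotProduct_sub, hA.eigenvector_dotProduct_mulVec, dotProduct_smul, smul_eq_mul]
      have := hzero i
      rw [mul_eq_zero] at this
      rcases this with h | h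
      · have : hA.eigenvalues i = hA.eigenvalues k := by linarith
        rw [this, sub_self]; simp
      · have : (hA.eigenvectorBasis i).ofLp ⬝ᵥ f = 0 := by simpa using h
        rw [this]; simp
    rw [hz] at e
    have h0 := (sum_eq_zero_iff_of_nonneg (fun i _ => sq_nonneg _)).1 e.symm
    ext i
    have := h0 i (mem_univ i)
    simp only [Pi.sub_apply] at this
    have h2 := pow_eq_zero_iff (two_ne_zero) |>.1 this
    linarith

end Matrix.IsHermitian

namespace SimpleGraph

/-- Integrality supplies the gap. τ itself may be any real number; if it is not an integer, z is
forced to be 0, which the later arguments also exploit. -/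
theorem HasIntegralSpectrum.exists_eigenfunction_near {V : Type*} [Fintype V] [DecidableEq V]
    {G : SimpleGraph V} [DecidableRel G.Adj] (hI : G.HasIntegralSpectrum) {τ δ : ℝ} (hδ : 0 ≤ δ)
    (hgap : ∀ m : ℤ, (m : ℝ) ≠ τ → δ ≤ |(m : ℝ) - τ|) (x : V → ℝ) :
    ∃ z : V → ℝ, (∀ u, ∑ w ∈ univ.filter (G.Adj u), z w = τ * z u) ∧
      δ ^ 2 * ∑ u, (x u - z u) ^ 2 ≤
        ∑ u, (∑ w ∈ univ.filter (G.Adj u), x w - τ * x u) ^ 2 := by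
  obtain ⟨z, hz, hle⟩ := G.isHermitian_adjMatrix_real.exists_eigenvector_near hδ (τ := τ)
    (fun i hi => by
      obtain ⟨m, hm⟩ := hI.eigenvalues_int i
      rw [hm] at hi ⊢
      exact hgap m hi) x
  refine ⟨z, fun u => ?_, ?_⟩
  · have := congrFun hz u
    rw [adjMatrix_mulVec_apply] at this
    simpa [neighborFinset_eq_filter] using this
  · simpa only [adjMatrix_mulVec_apply, neighborFinset_eq_filter] using hle

/-- A zero of a nonnegative eigenfunction forces zeros at all its neighbours, hence everywhere.
Dividing by the total sum makes the values at most 1. -/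
theorem Connected.exists_perron {V : Type*} [Fintype V] {G : SimpleGraph V} [DecidableRel G.Adj]
    (hG : G.Connected) : ∃ (f : V → ℝ) (τ : ℝ), (∀ u, 0 < f u ∧ f u ≤ 1) ∧ 0 ≤ τ ∧
      ∀ u, ∑ w ∈ univ.filter (G.Adj u), f w = τ * f u := by
  classical
  have := hG.nonempty
  obtain ⟨f, τ, hf0, hfne, hf⟩ := G.isHermitian_adjMatrix_real.exists_nonneg_eigenvector
    (fun i j => by rw [adjMatrix_apply]; split_ifs <;> norm_num)
  have heq : ∀ u, ∑ w ∈ univ.filter (G.Adj u), f w = τ * f u := by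
    intro u
    have := congrFun hf u
    rw [adjMatrix_mulVec_apply] at this
    simpa [neighborFinset_eq_filter] using this
  have hpos : ∀ u, 0 < f u := by
    intro u
    refine lt_of_le_of_ne (hf0 u) fun h0 => hfne ?_
    ext w
    obtain ⟨p⟩ := hG.preconnected u w
    have : ∀ a b, G.Walk a b → f a = 0 → f b = 0 := by
      intro a b p
      induction p with
      | nil => exact id
      | @cons a c b h _ ih =>
        intro ha
        apply ih
        have e := heq a
        rw [ha, mul_zero, sum_eq_zero_iff_of_nonneg fun _ _ => hf0 _] at e
        exact e c (by simpa using h)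
    exact this u w p h0.symm
  set s := ∑ w, f w with hs
  have hle : ∀ u, f u ≤ s := fun u => single_le_sum (f := f) (fun w _ => hf0 w) (mem_univ u)
  have hspos : 0 < s := lt_of_lt_of_le (hpos (Classical.arbitrary V)) (hle _)
  refine ⟨fun u => f u / s, τ, fun u => ⟨div_pos (hpos u) hspos, ?_⟩, ?_, fun u => ?_⟩
  · rw [div_le_one hspos]; exact hle u
  · have u := Classical.arbitrary V
    have e := heq u
    by_contra hneg
    have : τ * f u < 0 := mul_neg_of_neg_of_pos (not_le.1 hneg) (hpos u)
    rw [← e] at this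
    exact absurd (sum_nonneg fun w _ => hf0 w) (not_le.2 this)
  · rw [← sum_div, heq, mul_div_assoc]

theorem _root_.Real.exists_int_gap (τ : ℝ) :
    ∃ δ : ℝ, 0 < δ ∧ ∀ m : ℤ, (m : ℝ) ≠ τ → δ ≤ |(m : ℝ) - τ| := by
  by_cases h : ((round τ : ℤ) : ℝ) = τ
  · refine ⟨1, one_pos, fun m hm => ?_⟩
    rw [← h] at hm ⊢
    have : m - round τ ≠ 0 := by
      intro h0; apply hm; rw [sub_eq_zero.1 h0]
    exact_mod_cast Int.one_le_abs this
  · refine ⟨|τ - round τ|, abs_pos.2 (sub_ne_zero.2 fun e => h e.symm), fun m _ => ?_⟩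
    rw [abs_sub_comm (m : ℝ)]
    exact round_le τ m

/-- Uniform version of Perron's theorem for connected graphs of bounded size. -/
theorem exists_uniform_perron (b : ℕ) : ∃ δ : ℝ, 0 < δ ∧
    ∀ {V : Type*} [Fintype V] (G : SimpleGraph V) [DecidableRel G.Adj], Fintype.card V ≤ b →
      G.Connected → ∃ (f : V → ℝ) (τ : ℝ), (∀ u, δ ≤ f u ∧ f u ≤ 1) ∧ 0 ≤ τ ∧ τ * δ ≤ 1 ∧
      (∀ m : ℤ, (m : ℝ) ≠ τ → δ ≤ |(m : ℝ) - τ|) ∧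
      ∀ u, ∑ w ∈ univ.filter (G.Adj u), f w = τ * f u := by
  classical
  -- Up to isomorphism there are finitely many graphs on at most b vertices, so a positive constant
  -- for each of them yields a common one.
  have key : ∀ p : (Σ n : Fin (b + 1), SimpleGraph (Fin n)), ∃ δ : ℝ, 0 < δ ∧ (p.2.Connected →
      ∃ (f : Fin p.1 → ℝ) (τ : ℝ), (∀ u, δ ≤ f u ∧ f u ≤ 1) ∧ 0 ≤ τ ∧ τ * δ ≤ 1 ∧
      (∀ m : ℤ, (m : ℝ) ≠ τ → δ ≤ |(m : ℝ) - τ|) ∧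
      ∀ u, ∑ w ∈ univ.filter (p.2.Adj u), f w = τ * f u) := by
    rintro ⟨n, G⟩
    by_cases hG : G.Connected
    · have := hG.nonempty
      obtain ⟨f, τ, hf, hτ, heq⟩ := hG.exists_perron
      obtain ⟨δ₁, h1, hgap⟩ := Real.exists_int_gap τ
      obtain ⟨i, hi⟩ := Finite.exists_min f
      -- The three terms serve the lower bound on f, the distance to the integers, and τ δ ≤ 1.
      refine ⟨min (f i) (min δ₁ (1 / (τ + 1))), ?_, fun _ => ⟨f, τ, fun u => ⟨?_, (hf u).2⟩, hτ,
        ?_, fun m hm => ?_, heq⟩⟩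
      · exact lt_min (hf i).1 (lt_min h1 (by positivity))
      · exact (min_le_left _ _).trans (hi u)
      · have : min (f i) (min δ₁ (1 / (τ + 1))) ≤ 1 / (τ + 1) :=
          (min_le_right _ _).trans (min_le_right _ _)
        calc _ ≤ τ * (1 / (τ + 1)) := mul_le_mul_of_nonneg_left this hτ
          _ ≤ 1 := by rw [mul_one_div, div_le_one (by linarith)]; linarith
      · exact ((min_le_right _ _).trans (min_le_left _ _)).trans (hgap m hm)
    · exact ⟨1, one_pos, fun h => absurd h hG⟩
  choose δ hδ hp using key
  have : Nonempty (Σ n : Fin (b + 1), SimpleGraph (Fin n)) := ⟨⟨0, ⊥⟩⟩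
  obtain ⟨p₀, hp₀⟩ := Finite.exists_min δ
  refine ⟨δ p₀, hδ p₀, fun {V} _ G _ hV hG => ?_⟩
  let e := Fintype.equivFin V
  let G' : SimpleGraph (Fin (Fintype.card V)) := G.map e.toEmbedding
  let φ : G ≃g G' := Iso.map e G
  have hle := hp₀ ⟨⟨Fintype.card V, by omega⟩, G'⟩
  obtain ⟨f, τ, hf, h0, h1, h2, h3⟩ := hp ⟨⟨Fintype.card V, by omega⟩, G'⟩ (φ.connected_iff.1 hG)
  refine ⟨fun u => f (e u), τ, fun u => ⟨hle.trans (hf _).1, (hf _).2⟩, h0,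
    (mul_le_mul_of_nonneg_left hle h0).trans h1, fun m hm => hle.trans (h2 m hm), fun u => ?_⟩
  rw [← h3 (e u)]
  refine sum_bij (fun w _ => e w) ?_ ?_ ?_ ?_
  · intro w hw
    simp only [mem_filter, mem_univ, true_and] at hw ⊢
    exact (φ.map_adj_iff (v := u) (w := w)).2 hw
  · intro w _ w' _ h
    exact e.injective h
  · intro w hw
    simp only [mem_filter, mem_univ, true_and] at hw
    refine ⟨e.symm w, ?_, by simp⟩
    simp only [mem_filter, mem_univ, true_and]
    rw [← φ.map_adj_iff]
    have : φ (e.symm w) = w := e.apply_symm_apply w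
    rw [this]; exact hw
  · intro w _; rfl

/-- Perron functions of the components of a small induced subgraph. -/
theorem exists_uniform_component_perron (b : ℕ) : ∃ δ : ℝ, 0 < δ ∧
    ∀ {V : Type*} [Fintype V] [DecidableEq V] (G : SimpleGraph V) [DecidableRel G.Adj]
      (Q : Finset V), Q.card ≤ b → ∀ q ∈ Q, ∃ (U : Finset V) (f : V → ℝ) (τ : ℝ),
      q ∈ U ∧ U ⊆ Q ∧ (∀ u ∈ U, ∀ w ∈ Q, G.Adj u w → w ∈ U) ∧
      (∀ u ∈ U, δ ≤ f u ∧ f u ≤ 1) ∧ (∀ u ∉ U, f u = 0) ∧ 0 ≤ τ ∧ τ * δ ≤ 1 ∧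
      (∀ m : ℤ, (m : ℝ) ≠ τ → δ ≤ |(m : ℝ) - τ|) ∧
      ∀ u ∈ U, ∑ w ∈ univ.filter (G.Adj u), f w = τ * f u := by
  classical
  obtain ⟨δ, hδ, hp⟩ := exists_uniform_perron b
  refine ⟨δ, hδ, fun {V} _ _ G _ Q hQ q hq => ?_⟩
  set F := G.isolate (Q : Set V)ᶜ with hF
  have adjF : ∀ x y, F.Adj x y ↔ G.Adj x y ∧ x ∈ Q ∧ y ∈ Q := fun x y => by
    simp [hF, isolate_adj]
  set c := F.connectedComponentMk q with hc
  set U := univ.filter fun x => x ∈ c.supp with hU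
  have memU : ∀ x, x ∈ U ↔ x ∈ c.supp := fun x => by simp [hU]
  have hUQ : U ⊆ Q := by
    intro x hx
    rw [memU, ConnectedComponent.mem_supp_iff, hc, ConnectedComponent.eq] at hx
    obtain ⟨p⟩ := hx
    cases p with
    | nil => exact hq
    | cons h _ => exact ((adjF _ _).1 h).2.1
  have hcardU : Fintype.card c ≤ b := by
    refine le_trans ?_ hQ
    rw [← Fintype.card_coe]
    exact Fintype.card_le_of_injective
      (fun x : c => (⟨x.1, hUQ ((memU x.1).2 x.2)⟩ : Q))
      fun x y h => Subtype.ext (congrArg (fun z : Q => z.1) h)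
  obtain ⟨f, τ, hf, h0, h1, h2, h3⟩ := hp c.toSimpleGraph hcardU c.connected_toSimpleGraph
  refine ⟨U, fun x => if hx : x ∈ c.supp then f ⟨x, hx⟩ else 0, τ, ?_, hUQ, ?_, ?_, ?_, h0, h1, h2,
    ?_⟩
  · rw [memU]; rfl
  · intro u hu w hw huw
    rw [memU, ConnectedComponent.mem_supp_iff] at hu ⊢
    rw [← hu]
    exact ConnectedComponent.sound ((adjF _ _).2 ⟨huw.symm, hw, hUQ ((memU u).2 hu)⟩).reachable
  · intro u hu
    rw [memU] at hu
    simp only [hu, dif_pos]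
    exact hf _
  · intro u hu
    rw [memU] at hu
    simp only [hu, dif_neg, not_false_eq_true]
  · intro u hu
    have hu' := (memU u).1 hu
    simp only [hu', dif_pos]
    rw [← h3]
    symm
    refine sum_bij_ne_zero (fun w _ _ => w.1) ?_ ?_ ?_ ?_
    · intro w hw _
      simp only [mem_filter, mem_univ, true_and] at hw ⊢
      have : F.Adj u w := (c.toSimpleGraph_adj hu' w.2).1 hw
      exact ((adjF _ _).1 this).1
    · intro w _ _ w' _ _ h
      exact Subtype.ext h
    · intro w hw hne
      by_cases hwc : w ∈ c.supp
      · refine ⟨⟨w, hwc⟩, ?_, ?_, rfl⟩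
        · simp only [mem_filter, mem_univ, true_and] at hw ⊢
          have : F.Adj u w := (adjF _ _).2 ⟨hw, hUQ hu, hUQ ((memU w).2 hwc)⟩
          simpa [ConnectedComponent.toSimpleGraph_adj] using this
        · simpa [hwc] using hne
      · simp [hwc] at hne
    · intro w _ _
      simp

end SimpleGraph

end

/-! ### Components outside the hubs have Perron eigenvalue one -/

namespace SimpleGraph.IsHubDecomposition

open Finset

variable {V : Type*} [Fintype V] [DecidableEq V] {G : SimpleGraph V} [DecidableRel G.Adj]
  {H Q Y : Finset V} {hub lf : V → V} {K b N : ℕ}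

omit [Fintype V] [DecidableRel G.Adj] in
theorem leaf_notMem_mid (h : G.IsHubDecomposition H Q Y hub lf K b N) {y : V} (hy : y ∈ Y) :
    lf y ∉ Y := by
  intro hl
  have h1 := h.isArm y hy
  have h2 := h.isArm _ hl
  have e1 := (h1.adj_leaf _).1 ((h2.adj_mid _).2 (Or.inl rfl))
  have e2 := (h1.adj_leaf _).1 ((h2.adj_mid _).2 (Or.inr rfl))
  exact h2.ne (e1.trans e2.symm)

omit [Fintype V] [DecidableRel G.Adj] in
theorem leaf_injOn (h : G.IsHubDecomposition H Q Y hub lf K b N) :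
    Set.InjOn lf (Y : Set V) := by
  intro y hy y' hy' e
  have h1 := ((h.isArm y hy).adj_leaf y).2 rfl
  rw [e] at h1
  exact ((h.isArm y' hy').adj_leaf y).1 h1

omit [DecidableRel G.Adj] in
theorem sum_eq (h : G.IsHubDecomposition H Q Y hub lf K b N) (g : V → ℝ) :
    ∑ u, g u = ∑ v ∈ H, g v + ∑ q ∈ Q, g q + ∑ y ∈ Y, (g y + g (lf y)) := by
  have huniv : (univ : Finset V) = (H ∪ Q) ∪ (Y ∪ Y.image lf) := by
    ext x
    simp only [mem_univ, mem_union, mem_image, true_iff]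
    rcases h.cover x with h1 | h1 | h1 | ⟨y, hy, rfl⟩
    · exact Or.inl (Or.inl h1)
    · exact Or.inl (Or.inr h1)
    · exact Or.inr (Or.inl h1)
    · exact Or.inr (Or.inr ⟨y, hy, rfl⟩)
  have d1 : Disjoint H Q := Finset.disjoint_left.2 h.disjoint
  have d2 : Disjoint Y (Y.image lf) := by
    rw [Finset.disjoint_right]
    intro x hx
    obtain ⟨y, hy, rfl⟩ := mem_image.1 hx
    exact h.leaf_notMem_mid hy
  have d3 : Disjoint (H ∪ Q) (Y ∪ Y.image lf) := by
    rw [Finset.disjoint_right]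
    intro x hx hx'
    rw [mem_union] at hx hx'
    rcases hx with hx | hx
    · exact hx'.elim (h.mid_notMem x hx).1 (h.mid_notMem x hx).2
    · obtain ⟨y, hy, rfl⟩ := mem_image.1 hx
      exact hx'.elim (h.leaf_notMem y hy).1 (h.leaf_notMem y hy).2
  rw [huniv, sum_union d3, sum_union d1, sum_union d2, sum_image h.leaf_injOn, sum_add_distrib]

omit [Fintype V] [DecidableRel G.Adj] in
theorem adj_hub_mid (h : G.IsHubDecomposition H Q Y hub lf K b N) {v y : V} (hv : v ∈ H)
    (hy : y ∈ Y) : G.Adj v y ↔ hub y = v := by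
  rw [G.adj_comm, (h.isArm y hy).adj_mid]
  constructor
  · rintro (e | e)
    · exact e.symm
    · exact absurd (e ▸ hv) (h.leaf_notMem y hy).1
  · exact fun e => Or.inl e.symm

omit [Fintype V] [DecidableRel G.Adj] in
theorem not_adj_leaf (h : G.IsHubDecomposition H Q Y hub lf K b N) {x y : V} (hx : x ∉ Y)
    (hy : y ∈ Y) : ¬ G.Adj x (lf y) := fun hadj =>
  hx (((h.isArm y hy).adj_leaf x).1 hadj.symm ▸ hy)

omit [Fintype V] [DecidableRel G.Adj] in
theorem not_adj_rest_mid (h : G.IsHubDecomposition H Q Y hub lf K b N) {q y : V} (hq : q ∈ Q)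
    (hy : y ∈ Y) : ¬ G.Adj q y := by
  rw [G.adj_comm, (h.isArm y hy).adj_mid]
  rintro (e | e)
  · exact h.disjoint _ (h.hub_mem y hy) (e ▸ hq)
  · exact (h.leaf_notMem y hy).2 (e ▸ hq)

theorem sum_adj_mid (h : G.IsHubDecomposition H Q Y hub lf K b N) (g : V → ℝ) {y : V}
    (hy : y ∈ Y) : ∑ w ∈ univ.filter (G.Adj y), g w = g (hub y) + g (lf y) := by
  have : univ.filter (G.Adj y) = {hub y, lf y} := by
    ext z
    simp [(h.isArm y hy).adj_mid]
  rw [this, sum_pair (h.isArm y hy).ne]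

theorem sum_adj_leaf (h : G.IsHubDecomposition H Q Y hub lf K b N) (g : V → ℝ) {y : V}
    (hy : y ∈ Y) : ∑ w ∈ univ.filter (G.Adj (lf y)), g w = g y := by
  have : univ.filter (G.Adj (lf y)) = {y} := by
    ext z
    simp [(h.isArm y hy).adj_leaf]
  rw [this, sum_singleton]

theorem sum_adj_hub (h : G.IsHubDecomposition H Q Y hub lf K b N) (g : V → ℝ) {v : V}
    (hv : v ∈ H) : ∑ w ∈ univ.filter (G.Adj v), g w =
      ∑ w ∈ (H ∪ Q).filter (G.Adj v), g w + ∑ y ∈ Y.filter (fun y => hub y = v), g y := by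
  have hvY : v ∉ Y := fun hy => (h.mid_notMem v hy).1 hv
  have : univ.filter (G.Adj v) = (H ∪ Q).filter (G.Adj v) ∪ Y.filter (fun y => hub y = v) := by
    ext w
    simp only [mem_filter, mem_univ, true_and, mem_union]
    constructor
    · intro hw
      rcases h.cover w with h1 | h1 | h1 | ⟨y, hy, rfl⟩
      · exact Or.inl ⟨Or.inl h1, hw⟩
      · exact Or.inl ⟨Or.inr h1, hw⟩
      · exact Or.inr ⟨h1, (h.adj_hub_mid hv h1).1 hw⟩
      · exact absurd hw (h.not_adj_leaf hvY hy)
    · rintro (⟨-, hw⟩ | ⟨hw, e⟩)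
      · exact hw
      · exact (h.adj_hub_mid hv hw).2 e
  rw [this, sum_union]
  rw [Finset.disjoint_left]
  intro w hw hw'
  simp only [mem_filter, mem_union] at hw hw'
  exact hw.1.elim (h.mid_notMem w hw'.1).1 (h.mid_notMem w hw'.1).2

theorem sum_adj_rest (h : G.IsHubDecomposition H Q Y hub lf K b N) (g : V → ℝ) {q : V}
    (hq : q ∈ Q) : ∑ w ∈ univ.filter (G.Adj q), g w = ∑ w ∈ (H ∪ Q).filter (G.Adj q), g w := by
  congr 1
  ext w
  simp only [mem_filter, mem_univ, true_and, mem_union]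
  constructor
  · intro hw
    refine ⟨?_, hw⟩
    rcases h.cover w with h1 | h1 | h1 | ⟨y, hy, rfl⟩
    · exact Or.inl h1
    · exact Or.inr h1
    · exact absurd hw (h.not_adj_rest_mid hq h1)
    · exact absurd hw (h.not_adj_leaf (fun hy' => (h.mid_notMem q hy').2 hq) hy)
  · exact fun hw => hw.2

omit [Fintype V] in
/-- If `z` is uniformly close to `x`, then so are the sums over neighbours outside the arms. -/
theorem abs_sum_sub_le (h : G.IsHubDecomposition H Q Y hub lf K b N) {x z : V → ℝ} {ε : ℝ}
    (hε : ∀ u, |x u - z u| ≤ ε) (v : V) :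
    |∑ w ∈ (H ∪ Q).filter (G.Adj v), x w - ∑ w ∈ (H ∪ Q).filter (G.Adj v), z w| ≤
      (K + b) * ε := by
  have hε0 : 0 ≤ ε := (abs_nonneg _).trans (hε v)
  have hc : (((H ∪ Q).filter (G.Adj v)).card : ℝ) ≤ K + b := by
    have : ((H ∪ Q).filter (G.Adj v)).card ≤ K + b :=
      (card_le_card (filter_subset _ _)).trans
        ((card_union_le _ _).trans (add_le_add h.card_hubs h.card_rest))
    exact_mod_cast this
  rw [← sum_sub_distrib]
  refine (abs_sum_le_sum_abs _ _).trans ?_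
  refine (sum_le_card_nsmul _ _ ε fun w _ => hε w).trans ?_
  rw [nsmul_eq_mul]
  exact mul_le_mul_of_nonneg_right hc hε0

/-- In an integral graph with very large hubs, the components outside the hubs have Perron
eigenvalue `1`. -/
theorem perron_eq_one (b K : ℕ) {δ : ℝ} (hδ : 0 < δ) : ∃ N₀ : ℕ, ∀ {V : Type*} [Fintype V]
    [DecidableEq V] {G : SimpleGraph V} [DecidableRel G.Adj] {H Q Y : Finset V} {hub lf : V → V}
    {N : ℕ}, G.IsHubDecomposition H Q Y hub lf K b N → N₀ ≤ N → H.Nonempty → G.Connected →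
    G.HasIntegralSpectrum → ∀ {U : Finset V} {f : V → ℝ} {τ : ℝ}, U.Nonempty → U ⊆ Q →
      (∀ u ∈ U, ∀ w ∈ Q, G.Adj u w → w ∈ U) →
      (∀ u ∈ U, δ ≤ f u ∧ f u ≤ 1) → (∀ u ∉ U, f u = 0) → 0 ≤ τ → τ * δ ≤ 1 →
      (∀ m : ℤ, (m : ℝ) ≠ τ → δ ≤ |(m : ℝ) - τ|) →
      (∀ u ∈ U, ∑ w ∈ univ.filter (G.Adj u), f w = τ * f u) → τ = 1 := by
  -- Chosen so that the error (K + b) ε of a neighbour sum over H ∪ Q stays below δ.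
  set ε : ℝ := δ / (2 * (K + b + 1)) with hε
  have hε0 : 0 < ε := by positivity
  -- The first term brings the residual below δ² ε²; the second gives N > τ² + 1, as τ ≤ 1/δ.
  obtain ⟨N₀, hN₀⟩ := exists_nat_gt
    (K * ((1 / δ ^ 2 + 1) * b ^ 2) / (δ ^ 2 * ε ^ 2) + (1 / δ ^ 2 + 1))
  refine ⟨N₀, fun {V} _ _ {G} _ {H Q Y hub lf N} h hN hHne hconn hI {U f τ} hUne hUQ hUcl hfU hf0
    hτ hτδ hgap hf => ?_⟩
  have hA : 0 ≤ K * ((1 / δ ^ 2 + 1) * (b : ℝ) ^ 2) / (δ ^ 2 * ε ^ 2) := by positivity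
  have hNr : (N₀ : ℝ) ≤ N := by exact_mod_cast hN
  have hτ2 : τ ^ 2 ≤ 1 / δ ^ 2 := by
    rw [le_div_iff₀ (by positivity), ← mul_pow]
    have : 0 ≤ τ * δ := by positivity
    nlinarith
  have hNbig : τ ^ 2 + 1 < N := by linarith
  have hNpos : (0 : ℝ) < N := by nlinarith [sq_nonneg τ]
  have hfnn : ∀ u, 0 ≤ f u := by
    intro u
    by_cases hu : u ∈ U
    · exact hδ.le.trans (hfU u hu).1
    · rw [hf0 u hu]
  have hfnQ : ∀ u, u ∉ Q → f u = 0 := fun u hu => hf0 u fun hU => hu (hUQ hU)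
  have hfH : ∀ v ∈ H, f v = 0 := fun v hv => hfnQ v (h.disjoint v hv)
  have hfY : ∀ y ∈ Y, f y = 0 := fun y hy => hfnQ y (h.mid_notMem y hy).2
  have hfL : ∀ y ∈ Y, f (lf y) = 0 := fun y hy => hfnQ _ (h.leaf_notMem y hy).2
  let c : V → ℝ := fun v => ∑ w ∈ univ.filter (G.Adj v), f w
  let n : V → ℝ := fun v => ((Y.filter fun y => hub y = v).card : ℝ)
  have hnN : ∀ v ∈ H, (N : ℝ) ≤ n v := fun v hv => by
    simp only [n]; exact_mod_cast h.le_card_arms v hv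
  have hc0 : ∀ v, 0 ≤ c v := fun v => sum_nonneg fun w _ => hfnn w
  have hcb : ∀ v, c v ≤ b := by
    intro v
    calc c v ≤ ∑ w, f w := sum_le_sum_of_subset_of_nonneg (subset_univ _) fun w _ _ => hfnn w
      _ = ∑ w ∈ U, f w := (sum_subset (subset_univ U) fun w _ hw => hf0 w hw).symm
      _ ≤ U.card • (1 : ℝ) := sum_le_card_nsmul _ _ _ fun w hw => (hfU w hw).2
      _ ≤ b := by
        rw [nsmul_eq_mul, mul_one]
        exact_mod_cast (card_le_card hUQ).trans h.card_rest
  have hcH : ∀ v ∈ H, c v = ∑ w ∈ (H ∪ Q).filter (G.Adj v), f w := by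
    intro v hv
    simp only [c]
    rw [h.sum_adj_hub f hv, sum_eq_zero (s := Y.filter fun y => hub y = v)
      fun y hy => hfY y (mem_filter.1 hy).1, add_zero]
  have hcpos : ∀ v, c v ≠ 0 → δ ≤ c v := by
    intro v hv
    obtain ⟨u, hu, hfu⟩ := exists_ne_zero_of_sum_ne_zero hv
    have huU : u ∈ U := by
      by_contra hu'
      exact hfu (hf0 u hu')
    exact (hfU u huU).1.trans (single_le_sum (f := f) (fun w _ => hfnn w) hu)
  -- The Perron function, corrected on the mid vertices so that the equations at the hubs, where x
  -- vanishes, hold exactly. The residual lives on the arms and is O(1/N).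
  let x : V → ℝ := fun u => if u ∈ Y then -(c (hub u) / n (hub u)) else f u
  have hxY : ∀ y ∈ Y, x y = -(c (hub y) / n (hub y)) := fun y hy => if_pos hy
  have hxn : ∀ u, u ∉ Y → x u = f u := fun u hu => if_neg hu
  have hHY : ∀ v ∈ H, v ∉ Y := fun v hv hy => (h.mid_notMem v hy).1 hv
  have hQY : ∀ v ∈ Q, v ∉ Y := fun v hv hy => (h.mid_notMem v hy).2 hv
  have hxHQ : ∀ v, ∑ w ∈ (H ∪ Q).filter (G.Adj v), x w = ∑ w ∈ (H ∪ Q).filter (G.Adj v), f w := by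
    intro v
    refine sum_congr rfl fun w hw => hxn w ?_
    rw [mem_filter, mem_union] at hw
    exact hw.1.elim (hHY w) (hQY w)
  obtain ⟨z, hz, hnear⟩ := hI.exists_eigenfunction_near hδ.le hgap x
  have hres : ∑ u, (∑ w ∈ univ.filter (G.Adj u), x w - τ * x u) ^ 2 ≤
      K * ((1 / δ ^ 2 + 1) * b ^ 2) / N := by
    rw [h.sum_eq]
    have r1 : ∑ v ∈ H, (∑ w ∈ univ.filter (G.Adj v), x w - τ * x v) ^ 2 = 0 := by
      refine sum_eq_zero fun v hv => ?_
      have hn0 : n v ≠ 0 := (hNpos.trans_le (hnN v hv)).ne'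
      have : ∑ y ∈ Y.filter (fun y => hub y = v), x y = - c v := by
        rw [sum_congr rfl (g := fun _ => -(c v / n v))]
        · rw [sum_const, nsmul_eq_mul]
          change n v * _ = _
          field_simp
        · intro y hy
          rw [mem_filter] at hy
          rw [hxY y hy.1, hy.2]
      rw [h.sum_adj_hub x hv, hxHQ, ← hcH v hv, this, hxn v (hHY v hv), hfH v hv]
      simp
    have r2 : ∑ q ∈ Q, (∑ w ∈ univ.filter (G.Adj q), x w - τ * x q) ^ 2 = 0 := by
      refine sum_eq_zero fun q hq => ?_
      rw [h.sum_adj_rest x hq, hxHQ, ← h.sum_adj_rest f hq, hxn q (hQY q hq)]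
      by_cases hqU : q ∈ U
      · rw [hf q hqU]; simp
      · rw [hf0 q hqU, sum_eq_zero]
        · simp
        · intro w hw
          refine hf0 w fun hwU => hqU ?_
          exact hUcl w hwU q hq (mem_filter.1 hw).2.symm
    have r3 : ∑ y ∈ Y, ((∑ w ∈ univ.filter (G.Adj y), x w - τ * x y) ^ 2 +
        (∑ w ∈ univ.filter (G.Adj (lf y)), x w - τ * x (lf y)) ^ 2) =
        ∑ y ∈ Y, (τ ^ 2 + 1) * (c (hub y) / n (hub y)) ^ 2 := by
      refine sum_congr rfl fun y hy => ?_
      rw [h.sum_adj_mid x hy, h.sum_adj_leaf x hy, hxn _ (hHY _ (h.hub_mem y hy)),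
        hfH _ (h.hub_mem y hy), hxn _ (h.leaf_notMem_mid hy), hfL y hy, hxY y hy]
      ring
    have r4 : ∑ y ∈ Y, (τ ^ 2 + 1) * (c (hub y) / n (hub y)) ^ 2 =
        ∑ v ∈ H, (τ ^ 2 + 1) * c v ^ 2 / n v := by
      rw [← sum_fiberwise_of_maps_to h.hub_mem]
      refine sum_congr rfl fun v hv => ?_
      have hn0 : n v ≠ 0 := (hNpos.trans_le (hnN v hv)).ne'
      rw [sum_congr rfl (g := fun _ => (τ ^ 2 + 1) * (c v / n v) ^ 2)]
      · rw [sum_const, nsmul_eq_mul]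
        change n v * _ = _
        field_simp
      · intro y hy
        rw [(mem_filter.1 hy).2]
    rw [r1, r2, r3, r4, zero_add, zero_add]
    calc ∑ v ∈ H, (τ ^ 2 + 1) * c v ^ 2 / n v
        ≤ H.card • ((1 / δ ^ 2 + 1) * (b : ℝ) ^ 2 / N) := by
          refine sum_le_card_nsmul _ _ _ fun v hv => ?_
          have := hc0 v
          have := hcb v
          have := hnN v hv
          gcongr
      _ ≤ K * ((1 / δ ^ 2 + 1) * (b : ℝ) ^ 2 / N) := by
          rw [nsmul_eq_mul]
          have : (H.card : ℝ) ≤ K := by exact_mod_cast h.card_hubs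
          gcongr
      _ = _ := by ring
  have hclose : ∀ u, |x u - z u| ≤ ε := by
    intro u
    have h1 : (x u - z u) ^ 2 ≤ ∑ u, (x u - z u) ^ 2 :=
      single_le_sum (f := fun u => (x u - z u) ^ 2) (fun w _ => sq_nonneg _) (mem_univ u)
    have h2 : K * ((1 / δ ^ 2 + 1) * (b : ℝ) ^ 2) / N ≤ δ ^ 2 * ε ^ 2 := by
      rw [div_le_iff₀ hNpos, ← div_le_iff₀' (by positivity)]
      have : 0 < 1 / δ ^ 2 + 1 := by positivity
      linarith
    have h3 : δ ^ 2 * (x u - z u) ^ 2 ≤ δ ^ 2 * ε ^ 2 :=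
      (mul_le_mul_of_nonneg_left h1 (by positivity)).trans (hnear.trans (hres.trans h2))
    have h4 : (x u - z u) ^ 2 ≤ ε ^ 2 := le_of_mul_le_mul_left h3 (by positivity)
    exact abs_le_of_sq_le_sq h4 hε0.le
  have hS : ∀ v ∈ H, c v ≠ 0 → 0 < ∑ w ∈ (H ∪ Q).filter (G.Adj v), z w := by
    intro v hv hcv
    have h1 := h.abs_sum_sub_le hclose v
    rw [hxHQ, ← hcH v hv] at h1
    have h2 := hcpos v hcv
    have h3 : (K + b) * ε < δ := by
      rw [hε, ← mul_div_assoc, div_lt_iff₀ (by positivity)]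
      have : (0 : ℝ) ≤ K + b := by positivity
      nlinarith
    have h4 := (abs_le.1 h1).2
    linarith
  obtain ⟨v₀, hv₀, hcv₀⟩ : ∃ v ∈ H, c v ≠ 0 := by
    obtain ⟨q, hq⟩ := hUne
    obtain ⟨a, ha⟩ := hHne
    obtain ⟨p⟩ := hconn.preconnected q a
    obtain ⟨d, -, hd1, hd2⟩ := p.exists_boundary_dart (U : Set V) hq
      (fun hU => h.disjoint a ha (hUQ hU))
    have hadj := d.adj
    have hd1' : d.fst ∈ U := hd1
    have hd2' : d.snd ∉ U := hd2
    refine ⟨d.snd, ?_, ?_⟩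
    · rcases h.cover d.snd with h1 | h1 | h1 | ⟨y, hy, e⟩
      · exact h1
      · exact absurd (hUcl _ hd1' _ h1 hadj) hd2'
      · exact absurd hadj (h.not_adj_rest_mid (hUQ hd1') h1)
      · rw [e] at hadj
        exact absurd hadj (h.not_adj_leaf (hQY _ (hUQ hd1')) hy)
    · have h1 : f d.fst ≤ c d.snd := single_le_sum (f := f) (fun w _ => hfnn w)
        (by simpa using hadj.symm)
      have h2 := (hfU _ hd1').1
      have : 0 < c d.snd := by linarith
      exact this.ne'
  have hmid : ∀ y ∈ Y, (τ ^ 2 - 1) * z y = τ * z (hub y) := by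
    intro y hy
    have e1 := hz y
    have e2 := hz (lf y)
    rw [h.sum_adj_mid z hy] at e1
    rw [h.sum_adj_leaf z hy] at e2
    linear_combination -τ * e1 - e2
  -- Eliminating the arms ties z v to the neighbour sum over H ∪ Q. For τ > 1 the coefficient of z v
  -- is negative, so a positive sum forces z v < 0.
  have hhub : ∀ v ∈ H, (τ ^ 2 - 1) * ∑ w ∈ (H ∪ Q).filter (G.Adj v), z w =
      -(τ * (n v - (τ ^ 2 - 1))) * z v := by
    intro v hv
    have e1 := hz v
    rw [h.sum_adj_hub z hv] at e1
    have e2 : (τ ^ 2 - 1) * ∑ y ∈ Y.filter (fun y => hub y = v), z y = n v * (τ * z v) := by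
      rw [mul_sum, sum_congr rfl (g := fun _ => τ * z v)]
      · rw [sum_const, nsmul_eq_mul]
      · intro y hy
        rw [mem_filter] at hy
        rw [hmid y hy.1, hy.2]
    linear_combination (τ ^ 2 - 1) * e1 - e2
  by_contra hne
  rcases hτ.eq_or_lt with h0 | hτpos
  · have e := hhub v₀ hv₀
    have := hS v₀ hv₀ hcv₀
    rw [← h0] at e
    simp at e
    linarith
  -- Along an edge of U, f w ≤ τ f u ≤ τ² f w, which excludes 0 < τ < 1.
  have hτ1 : 1 < τ := by
    obtain ⟨u, hu⟩ := hUne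
    have hfu : 0 < f u := hδ.trans_le (hfU u hu).1
    have e := hf u hu
    have hne0 : ∑ w ∈ univ.filter (G.Adj u), f w ≠ 0 := by
      rw [e]; positivity
    obtain ⟨w, hw, hfw⟩ := exists_ne_zero_of_sum_ne_zero hne0
    have hwU : w ∈ U := by
      by_contra hw'
      exact hfw (hf0 w hw')
    have hadj : G.Adj u w := (mem_filter.1 hw).2
    have e' := hf w hwU
    have l1 : f w ≤ τ * f u := e ▸ single_le_sum (f := f) (fun w _ => hfnn w) hw
    have l2 : f u ≤ τ * f w := e' ▸ single_le_sum (f := f) (fun w _ => hfnn w)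
      (mem_filter.2 ⟨mem_univ _, hadj.symm⟩)
    by_contra hle
    have hlt : τ < 1 := lt_of_le_of_ne (not_lt.1 hle) hne
    have hfw0 : 0 < f w := lt_of_le_of_ne (hfnn w) (Ne.symm hfw)
    nlinarith
  have hsign : ∀ v ∈ H, c v ≠ 0 → z v < 0 := by
    intro v hv hcv
    have e := hhub v hv
    have hs := hS v hv hcv
    have h1 : 0 < τ ^ 2 - 1 := by nlinarith
    have h2 : 0 < τ * (n v - (τ ^ 2 - 1)) := by
      have := hnN v hv
      apply mul_pos hτpos
      linarith
    have h3 : 0 < -(τ * (n v - (τ ^ 2 - 1))) * z v := e ▸ mul_pos h1 hs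
    by_contra hz0
    nlinarith
  -- Pair f with z: f satisfies the equation for τ except at the hubs, so only the hub terms remain.
  -- Their sum cannot vanish, since z is negative at every hub meeting U.
  have hpair : ∑ v ∈ H, c v * z v = 0 := by
    have e := sum_mul_adj_comm (F := G) f z
    simp_rw [hz] at e
    have e' : ∑ u, (c u * z u - f u * (τ * z u)) = 0 := by
      rw [sum_sub_distrib]
      simp only [c]
      rw [← e, sub_self]
    rw [h.sum_eq] at e'
    rw [sum_congr rfl (g := fun v => c v * z v) (fun v hv => by rw [hfH v hv]; ring)] at e'
    rw [sum_eq_zero (s := Q), sum_eq_zero (s := Y), add_zero, add_zero] at e'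
    · exact e'
    · intro y hy
      simp only [c]
      rw [h.sum_adj_mid f hy, h.sum_adj_leaf f hy, hfH _ (h.hub_mem y hy), hfL y hy, hfY y hy]
      ring
    · intro q hq
      by_cases hqU : q ∈ U
      · simp only [c]
        rw [hf q hqU]; ring
      · have : c q = 0 := by
          refine sum_eq_zero fun w hw => hf0 w fun hwU => hqU ?_
          exact hUcl w hwU q hq (mem_filter.1 hw).2.symm
        rw [this, hf0 q hqU]; ring
  have hlt : ∑ v ∈ H, c v * z v < 0 := by
    refine sum_neg' (fun v hv => ?_) ⟨v₀, hv₀, ?_⟩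
    · by_cases hcv : c v = 0
      · rw [hcv, zero_mul]
      · exact mul_nonpos_of_nonneg_of_nonpos (hc0 v) (hsign v hv hcv).le
    · exact mul_neg_of_pos_of_neg (lt_of_le_of_ne (hc0 v₀) hcv₀.symm) (hsign v₀ hv₀ hcv₀)
  linarith

end SimpleGraph.IsHubDecomposition

/-! ### Integer matrices with eigenvalues one below a square -/

section

open Finset
open scoped Matrix

set_option maxHeartbeats 1000000 in
/-- If a symmetric nonnegative integer matrix with bounded off-diagonal entries and very large
diagonal entries has only eigenvalues of the form `k ^ 2 - 1`, then it is diagonal. -/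
theorem Matrix.IsHermitian.offDiag_eq_zero_of_sq (b K : ℕ) : ∃ N₀ : ℕ, ∀ {ι : Type*} [Fintype ι]
    [DecidableEq ι] {A : Matrix ι ι ℝ} (hA : A.IsHermitian), Fintype.card ι ≤ K →
    (∀ i j, ∃ m : ℕ, A i j = m) → (∀ i, (N₀ : ℝ) ≤ A i i) → (∀ i j, i ≠ j → A i j ≤ b) →
    (∀ i, 0 < hA.eigenvalues i → ∃ k : ℕ, 1 + hA.eigenvalues i = (k : ℝ) ^ 2) →
    ∀ i j, i ≠ j → A i j = 0 := by
  classical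
  -- D exceeds the off-diagonal row sums by at least 1. The gap g makes the later error ε = 2 D / g
  -- satisfy D ε < 1/2.
  set D : ℝ := K * b + 1 with hD
  set g : ℝ := 4 * (D + 1) ^ 2 with hg
  have hD1 : 1 ≤ D := by rw [hD]; have : (0 : ℝ) ≤ K * b := by positivity
                         linarith
  have hg0 : 0 < g := by positivity
  obtain ⟨N₀, hN₀⟩ := exists_nat_gt (D + (g + 1) ^ 2)
  refine ⟨N₀, fun {ι} _ _ {A} hA hK hint hdiag hoff hsq => ?_⟩
  have hnn : ∀ i j, 0 ≤ A i j := fun i j => by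
    obtain ⟨m, hm⟩ := hint i j
    rw [hm]; positivity
  have hsymm : ∀ i j, A i j = A j i := fun i j => by
    have := hA.apply i j
    simpa using this.symm
  by_contra hcon
  push Not at hcon
  obtain ⟨i₁, j₁, hij₁, hA₁⟩ := hcon
  -- The largest diagonal entry among rows with a nonzero off-diagonal entry; maximality fixes a
  -- sign in `hpos`.
  obtain ⟨v, hv, hmax⟩ := exists_max_image (univ.filter fun i => ∃ j, i ≠ j ∧ A i j ≠ 0)
    (fun i => A i i) ⟨i₁, mem_filter.2 ⟨mem_univ _, j₁, hij₁, hA₁⟩⟩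
  obtain ⟨-, w, hvw, hAvw⟩ := mem_filter.1 hv
  have hsumoff : ∀ (u : ι) (z : ι → ℝ) (ε : ℝ), 0 ≤ ε → ∀ s : Finset ι, u ∉ s →
      (∀ j ∈ s, |z j| ≤ ε) → |∑ j ∈ s, A u j * z j| ≤ K * b * ε := by
    intro u z ε hε s hus hz
    refine (abs_sum_le_sum_abs _ _).trans ?_
    calc ∑ j ∈ s, |A u j * z j| ≤ s.card • ((b : ℝ) * ε) := by
          refine sum_le_card_nsmul _ _ _ fun j hj => ?_
          rw [abs_mul, abs_of_nonneg (hnn u j)]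
          have := hoff u j fun e => hus (e ▸ hj)
          have := hz j hj
          gcongr
      _ ≤ K * b * ε := by
          rw [nsmul_eq_mul, ← mul_assoc]
          have : (s.card : ℝ) ≤ K := by exact_mod_cast (card_le_univ s).trans hK
          gcongr
  let e : ι → ℝ := Pi.single v 1
  have hAe : ∀ i, (A *ᵥ e) i = A i v := fun i => by simp [e]
  have hresid : ∀ s : ℝ, ∑ i, ((A *ᵥ e) i - s * e i) ^ 2 =
      (A v v - s) ^ 2 + ∑ i ∈ univ.erase v, A i v ^ 2 := by
    intro s
    rw [← add_sum_erase _ _ (mem_univ v)]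
    congr 1
    · rw [hAe]; simp [e]
    · refine sum_congr rfl fun i hi => ?_
      rw [hAe]; simp [e, ne_of_mem_erase hi]
  have hoffsq : ∑ i ∈ univ.erase v, A i v ^ 2 ≤ D ^ 2 := by
    calc ∑ i ∈ univ.erase v, A i v ^ 2 ≤ (univ.erase v).card • ((b : ℝ) ^ 2) := by
          refine sum_le_card_nsmul _ _ _ fun j hj => ?_
          have := hoff j v (ne_of_mem_erase hj)
          have := hnn j v
          gcongr
      _ ≤ K * (b : ℝ) ^ 2 := by
          rw [nsmul_eq_mul]
          have : ((univ.erase v).card : ℝ) ≤ K := by exact_mod_cast (card_le_univ _).trans hK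
          gcongr
      _ ≤ D ^ 2 := by
          rw [hD]
          have h1 : (0 : ℝ) ≤ K * b := by positivity
          have h2 : (K : ℝ) * b ^ 2 ≤ (K * b) ^ 2 := by
            rcases Nat.eq_zero_or_pos K with h | h
            · simp [h]
            · have : (1 : ℝ) ≤ K := by exact_mod_cast h
              have h3 : (0 : ℝ) ≤ (b : ℝ) ^ 2 := by positivity
              nlinarith
          nlinarith
  -- The unit vector at v has residual at most D for the value A v v, so some eigenvalue lies within
  -- D of it.
  obtain ⟨k₀, hk₀⟩ : ∃ i, (hA.eigenvalues i - A v v) ^ 2 ≤ D ^ 2 := by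
    by_contra hfar
    push Not at hfar
    have p1 := hA.sum_sq_eigenvector_dotProduct e
    have p2 := hA.sum_sq_eigenvector_dotProduct (A *ᵥ e - A v v • e)
    have p3 : ∑ j, e j ^ 2 = 1 := by
      rw [sum_eq_single v] <;> simp +contextual [e]
    simp only [Pi.sub_apply, Pi.smul_apply, smul_eq_mul] at p2
    rw [hresid, sub_self] at p2
    rw [p3] at p1
    have p4 : ∀ i, ((hA.eigenvectorBasis i).ofLp ⬝ᵥ (A *ᵥ e - A v v • e)) ^ 2 =
        (hA.eigenvalues i - A v v) ^ 2 * ((hA.eigenvectorBasis i).ofLp ⬝ᵥ e) ^ 2 := by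
      intro i
      rw [dotProduct_sub, hA.eigenvector_dotProduct_mulVec, dotProduct_smul, smul_eq_mul]
      ring
    have p5 : ∑ i, D ^ 2 * ((hA.eigenvectorBasis i).ofLp ⬝ᵥ e) ^ 2 <
        ∑ i, ((hA.eigenvectorBasis i).ofLp ⬝ᵥ (A *ᵥ e - A v v • e)) ^ 2 := by
      obtain ⟨i, -, hi⟩ := exists_ne_zero_of_sum_ne_zero (p1 ▸ one_ne_zero)
      apply sum_lt_sum
      · intro i _
        rw [p4]
        exact mul_le_mul_of_nonneg_right (hfar i).le (sq_nonneg _)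
      · refine ⟨i, mem_univ _, ?_⟩
        rw [p4]
        exact mul_lt_mul_of_pos_right (hfar i) (lt_of_le_of_ne (sq_nonneg _) hi.symm)
    rw [← mul_sum, p1, p2] at p5
    linarith
  set s := hA.eigenvalues k₀ with hs
  have hsD := abs_le_of_sq_le_sq hk₀ (by linarith)
  have hsbig : (g + 1) ^ 2 < s := by
    have := (abs_le.1 hsD).1
    have := hdiag v
    linarith
  obtain ⟨k, hk⟩ := hsq k₀ (by rw [← hs]; nlinarith)
  rw [← hs] at hk
  have hkg : g + 1 ≤ k := by
    by_contra hlt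
    push Not at hlt
    have : (0 : ℝ) ≤ k := by positivity
    nlinarith
  -- Distinct squares, one of them k ^ 2 with k ≥ g + 1, differ by at least 2 k - 1.
  have hgap : ∀ i, hA.eigenvalues i ≠ s → g ≤ |hA.eigenvalues i - s| := by
    intro i hi
    rcases le_or_gt (hA.eigenvalues i) 0 with h0 | h0
    · rw [abs_sub_comm]
      refine le_trans ?_ (le_abs_self _)
      nlinarith
    · obtain ⟨k', hk'⟩ := hsq i h0
      have hkk : k' ≠ k := by
        rintro rfl
        apply hi
        linarith
      have : hA.eigenvalues i - s = (k' : ℝ) ^ 2 - (k : ℝ) ^ 2 := by linarith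
      rw [this]
      have hk'0 : (0 : ℝ) ≤ k' := by positivity
      rcases lt_or_gt_of_ne hkk with hlt | hlt
      · have h1 : (k' : ℝ) + 1 ≤ k := by exact_mod_cast hlt
        rw [abs_sub_comm]
        refine le_trans ?_ (le_abs_self _)
        nlinarith
      · have h1 : (k : ℝ) + 1 ≤ k' := by exact_mod_cast hlt
        refine le_trans ?_ (le_abs_self _)
        nlinarith
  obtain ⟨z, hz, hnear⟩ := hA.exists_eigenvector_near hg0.le hgap e
  rw [hresid] at hnear
  set ε : ℝ := 2 * D / g with hε
  have hε0 : 0 ≤ ε := by positivity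
  have hε1 : D * ε < 1 / 2 := by
    rw [hε, ← mul_div_assoc, div_lt_iff₀ hg0, hg]
    nlinarith
  have hclose : ∀ i, |e i - z i| ≤ ε := by
    intro i
    have h1 : (e i - z i) ^ 2 ≤ ∑ i, (e i - z i) ^ 2 :=
      single_le_sum (f := fun i => (e i - z i) ^ 2) (fun _ _ => sq_nonneg _) (mem_univ i)
    have h2 : (A v v - s) ^ 2 ≤ D ^ 2 := by
      have : (A v v - s) ^ 2 = (s - A v v) ^ 2 := by ring
      rw [this]; exact hk₀
    have h3 : g ^ 2 * (e i - z i) ^ 2 ≤ 2 * D ^ 2 := by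
      have := mul_le_mul_of_nonneg_left h1 (sq_nonneg g)
      linarith
    have h4 : g ^ 2 * ε ^ 2 = 4 * D ^ 2 := by
      rw [hε]; field_simp; norm_num
    have h5 : (e i - z i) ^ 2 ≤ ε ^ 2 := by
      have : g ^ 2 * (e i - z i) ^ 2 ≤ g ^ 2 * ε ^ 2 := by
        rw [h4]; linarith [sq_nonneg D]
      exact le_of_mul_le_mul_left this (by positivity)
    exact abs_le_of_sq_le_sq h5 hε0
  have hzv : 1 - ε ≤ z v := by
    have := (abs_le.1 (hclose v)).2
    simp only [e, Pi.single_eq_same] at this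
    linarith
  have hzo : ∀ j, j ≠ v → |z j| ≤ ε := by
    intro j hj
    have := hclose j
    simpa [e, hj] using this
  have hrow : ∀ i, A i i * z i + ∑ j ∈ univ.erase i, A i j * z j = s * z i := by
    intro i
    have := congrFun hz i
    rw [Pi.smul_apply, smul_eq_mul] at this
    rw [← this, mulVec, dotProduct, ← add_sum_erase _ _ (mem_univ i)]
  have hεD : ε ≤ D * ε := le_mul_of_one_le_left hε0 hD1
  have hKbε : (K : ℝ) * b * ε = D * ε - ε := by rw [hD]; ring
  have hvrow := hsumoff v z ε hε0 (univ.erase v) (by simp) fun j hj => hzo j (ne_of_mem_erase hj)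
  -- Both numbers are integers, and row v of the eigenvector equation shows that they differ by less
  -- than 1.
  have hint_s : A v v = s := by
    obtain ⟨m, hm⟩ := hint v v
    have e1 := hrow v
    have e2 : |(A v v - s) * z v| < 1 / 2 := by
      have : (A v v - s) * z v = -∑ j ∈ univ.erase v, A v j * z j := by linarith
      rw [this, abs_neg]
      linarith
    rw [abs_mul] at e2
    have e3 : 1 / 2 ≤ |z v| := by
      refine le_trans ?_ (le_abs_self _)
      linarith
    have e4 : |A v v - s| < 1 := by
      by_contra hge
      push Not at hge
      have := mul_le_mul hge e3 (by norm_num) (abs_nonneg _)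
      linarith
    have e5 : A v v - s = (((m : ℤ) - ((k : ℤ) ^ 2 - 1) : ℤ) : ℝ) := by
      push_cast
      linarith
    rw [e5] at e4
    have e6 : |((m : ℤ) - ((k : ℤ) ^ 2 - 1) : ℤ)| < 1 := by exact_mod_cast e4
    rw [Int.abs_lt_one_iff] at e6
    rw [e6] at e5
    push_cast at e5
    linarith
  have hsum0 : ∑ j ∈ univ.erase v, A v j * z j = 0 := by
    have := hrow v
    rw [hint_s] at this
    linarith
  -- In row j the term A j v * z v dominates, so (s - A j j) z j > 0, while A j j ≤ A v v = s.
  -- Positive z j for all j joined to v contradicts `hsum0`.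
  have hpos : ∀ j, j ≠ v → A v j ≠ 0 → 0 < z j := by
    intro j hj hAj
    have hle : A j j ≤ A v v := hmax j (mem_filter.2 ⟨mem_univ _, v, hj, by rwa [hsymm]⟩)
    have h1 : 1 ≤ A j v := by
      rw [hsymm]
      obtain ⟨m, hm⟩ := hint v j
      rw [hm] at hAj ⊢
      have : m ≠ 0 := by exact_mod_cast hAj
      exact_mod_cast Nat.one_le_iff_ne_zero.2 this
    have e1 := hrow j
    rw [← add_sum_erase _ _ (mem_erase.2 ⟨hj.symm, mem_univ v⟩)] at e1
    have e2 := hsumoff j z ε hε0 ((univ.erase j).erase v) (by simp)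
      fun i hi => hzo i (ne_of_mem_erase hi)
    have e3 := (abs_le.1 e2).1
    have e4 : z v ≤ A j v * z v := le_mul_of_one_le_left (by linarith) h1
    by_contra hneg
    push Not at hneg
    have e5 : 0 ≤ (A j j - s) * z j := by
      rw [← hint_s]
      exact mul_nonneg_of_nonpos_of_nonpos (by linarith) hneg
    linarith
  have : 0 < ∑ j ∈ univ.erase v, A v j * z j := by
    refine sum_pos' (fun j hj => ?_) ⟨w, mem_erase.2 ⟨hvw.symm, mem_univ w⟩, ?_⟩
    · by_cases h0 : A v j = 0
      · rw [h0, zero_mul]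
      · exact mul_nonneg (hnn v j) (hpos j (ne_of_mem_erase hj) h0).le
    · exact mul_pos (lt_of_le_of_ne (hnn v w) (Ne.symm hAvw)) (hpos w hvw.symm hAvw)
  linarith

end

/-! ### Odd connections between hubs -/

section

open Finset
open scoped Matrix

namespace SimpleGraph

/-- The vertices outside a set `H` of hubs are perfectly matched by `p`, with no other edges
outside `H`; every hub carries at least `N` pendant edges of the matching. -/
structure IsHubMatching {V : Type*} [Fintype V] [DecidableEq V] (G : SimpleGraph V)
    [DecidableRel G.Adj] (H : Finset V) (p : V → V) (K b N : ℕ) : Prop where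
  card_hubs : H.card ≤ K
  partner_notMem : ∀ x ∉ H, p x ∉ H
  adj_partner : ∀ x ∉ H, G.Adj x (p x)
  eq_or_mem : ∀ x ∉ H, ∀ z, G.Adj x z → z = p x ∨ z ∈ H
  le_card_arms : ∀ v ∈ H, N ≤ (univ.filter fun u => u ∉ H ∧ G.Adj u v ∧
    (∀ w ∈ H, G.Adj u w → w = v) ∧ ∀ w ∈ H, ¬ G.Adj (p u) w).card
  card_shared_le : ∀ v ∈ H, ∀ w ∈ H, v ≠ w → (univ.filter fun u => u ∉ H ∧ G.Adj u w ∧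
    (G.Adj u v ∨ G.Adj (p u) v)).card ≤ b

theorem isRoot_charpoly_of_eigenfunction {V : Type*} [Fintype V] [DecidableEq V]
    {G : SimpleGraph V} [DecidableRel G.Adj] {z : V → ℝ} (hz0 : z ≠ 0) {t : ℝ}
    (hz : ∀ u, ∑ w ∈ univ.filter (G.Adj u), z w = t * z u) :
    (G.adjMatrix ℝ).charpoly.IsRoot t := by
  have h : (G.adjMatrix ℝ) *ᵥ z = t • z := by
    ext u
    rw [adjMatrix_mulVec_apply, neighborFinset_eq_filter, hz u, Pi.smul_apply, smul_eq_mul]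
  have : Module.End.HasEigenvalue (Matrix.toLin' (G.adjMatrix ℝ)) t :=
    Module.End.hasEigenvalue_of_hasEigenvector (x := z)
      ⟨Module.End.mem_eigenspace_iff.2 (by rw [Matrix.toLin'_apply, h]), hz0⟩
  rwa [Module.End.hasEigenvalue_iff_isRoot_charpoly, Matrix.charpoly_toLin'] at this

namespace IsHubMatching

variable {V : Type*} [Fintype V] [DecidableEq V] {G : SimpleGraph V} [DecidableRel G.Adj]
  {H : Finset V} {p : V → V} {K b N : ℕ}

theorem partner_partner (h : G.IsHubMatching H p K b N) {x : V} (hx : x ∉ H) : p (p x) = x := by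
  rcases h.eq_or_mem _ (h.partner_notMem x hx) x (h.adj_partner x hx).symm with e | e
  · exact e.symm
  · exact absurd e hx

theorem sum_adj_of_notMem (h : G.IsHubMatching H p K b N) (g : V → ℝ) {u : V} (hu : u ∉ H) :
    ∑ w ∈ univ.filter (G.Adj u), g w = g (p u) + ∑ w ∈ H.filter (G.Adj u), g w := by
  have : univ.filter (G.Adj u) = insert (p u) (H.filter (G.Adj u)) := by
    ext z
    simp only [mem_filter, mem_univ, true_and, mem_insert]
    constructor
    · intro hz
      rcases h.eq_or_mem u hu z hz with e | e
      · exact Or.inl e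
      · exact Or.inr ⟨e, hz⟩
    · rintro (rfl | e)
      · exact h.adj_partner u hu
      · exact e.2
  rw [this, sum_insert]
  intro hmem
  exact h.partner_notMem u hu (mem_filter.1 hmem).1

theorem sum_adj_split (g : V → ℝ) (v : V) : ∑ w ∈ univ.filter (G.Adj v), g w =
    ∑ w ∈ H.filter (G.Adj v), g w + ∑ u ∈ (univ \ H).filter (G.Adj v), g u := by
  rw [← sum_union]
  · congr 1
    ext z
    simp only [mem_filter, mem_univ, true_and, mem_union, mem_sdiff]
    tauto
  · rw [Finset.disjoint_left]
    intro x hx hx'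
    simp only [mem_filter, mem_sdiff] at hx hx'
    exact hx'.1.2 hx.1

/-- Signed number of connections of length one or three between two hubs. -/
def link (G : SimpleGraph V) [DecidableRel G.Adj] (H : Finset V) (p : V → V) (w v : V) : ℝ :=
  (if G.Adj w v then 1 else 0) -
    ((univ.filter fun u => u ∉ H ∧ G.Adj u w ∧ G.Adj (p u) v).card : ℝ)

/-- An approximate null vector concentrated at the hub `v`. -/
def hubVector (G : SimpleGraph V) [DecidableRel G.Adj] (H : Finset V) (p : V → V) (v : V) :
    V → ℝ := fun x => if x ∈ H then (if x = v then 1 else 0) else if G.Adj (p x) v then -1 else 0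

/-- If u is adjacent to v, the value 1 at v cancels the value -1 at p u. -/
theorem sum_adj_hubVector_of_notMem (h : G.IsHubMatching H p K b N) {v : V} (hv : v ∈ H) {u : V}
    (hu : u ∉ H) : ∑ w ∈ univ.filter (G.Adj u), hubVector G H p v w = 0 := by
  rw [h.sum_adj_of_notMem _ hu]
  have h1 : hubVector G H p v (p u) = if G.Adj u v then -1 else 0 := by
    simp [hubVector, h.partner_notMem u hu, h.partner_partner hu]
  have h2 : ∑ w ∈ H.filter (G.Adj u), hubVector G H p v w = if G.Adj u v then 1 else 0 := by
    rw [sum_congr rfl (g := fun w => if w = v then 1 else 0)]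
    · rw [sum_ite_eq']
      simp [hv]
    · intro w hw
      simp [hubVector, (mem_filter.1 hw).1]
  rw [h1, h2]
  split_ifs <;> norm_num

theorem sum_adj_hubVector_of_mem {v : V} (hv : v ∈ H) (w : V) :
    ∑ x ∈ univ.filter (G.Adj w), hubVector G H p v x = link G H p w v := by
  rw [sum_adj_split (H := H)]
  have h2 : ∑ x ∈ H.filter (G.Adj w), hubVector G H p v x = if G.Adj w v then 1 else 0 := by
    rw [sum_congr rfl (g := fun w => if w = v then 1 else 0)]
    · rw [sum_ite_eq']
      simp [hv]
    · intro w hw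
      simp [hubVector, (mem_filter.1 hw).1]
  have h3 : ∑ x ∈ (univ \ H).filter (G.Adj w), hubVector G H p v x =
      -((univ.filter fun u => u ∉ H ∧ G.Adj u w ∧ G.Adj (p u) v).card : ℝ) := by
    rw [sum_congr rfl (g := fun x => -(if G.Adj (p x) v then 1 else 0))]
    · rw [sum_neg_distrib, sum_boole, filter_filter]
      congr 3
      ext u
      simp [G.adj_comm w u]
    · intro x hx
      have : x ∉ H := (mem_sdiff.1 (mem_filter.1 hx).1).2
      simp only [hubVector, this, if_false]
      split_ifs <;> norm_num
  rw [h2, h3, link]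
  ring

/-- A connection from v to itself would be a triangle v, u, p u. -/
theorem link_self (h : G.IsHubMatching H p K b N) (hG : G.IsAcyclic) (v : V) :
    link G H p v v = 0 := by
  have : (univ.filter fun u => u ∉ H ∧ G.Adj u v ∧ G.Adj (p u) v) = ∅ := by
    rw [filter_eq_empty_iff]
    rintro u - ⟨hu, h1, h2⟩
    have h3 := h.adj_partner u hu
    have := hG.cliqueFree (n := 3) le_rfl
    exact this {u, p u, v} (is3Clique_triple_iff.2 ⟨h3, h1, h2⟩)
  simp [link, this]

/-- In an integral forest with very large hubs there are no odd connections between hubs. -/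
theorem link_eq_zero (b K : ℕ) : ∃ N₀ : ℕ, ∀ {V : Type*} [Fintype V] [DecidableEq V]
    {G : SimpleGraph V} [DecidableRel G.Adj] {H : Finset V} {p : V → V} {N : ℕ},
    G.IsHubMatching H p K b N → N₀ ≤ N → G.IsAcyclic → G.HasIntegralSpectrum →
    ∀ v ∈ H, ∀ w ∈ H, link G H p v w = 0 := by
  -- Then ε (1 + K (1 + b)) = 1/2, so a main term of at least 1 - ε beats an error of at most K (1 +
  -- b) ε.
  set ε : ℝ := 1 / (2 * (1 + K * (1 + b))) with hε
  have hε0 : 0 < ε := by positivity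
  obtain ⟨N₀, hN₀⟩ := exists_nat_gt (K * (1 + (b : ℝ)) ^ 2 / ε ^ 2)
  refine ⟨N₀, fun {V} _ _ {G} _ {H p N} h hN hG hI => ?_⟩
  have hNr : (N₀ : ℝ) ≤ N := by exact_mod_cast hN
  have hself := h.link_self hG
  have hlink : ∀ w ∈ H, ∀ v ∈ H, |link G H p w v| ≤ 1 + b := by
    intro w hw v hv
    by_cases hwv : w = v
    · rw [hwv, hself, abs_zero]; positivity
    have h1 : ((univ.filter fun u => u ∉ H ∧ G.Adj u w ∧ G.Adj (p u) v).card : ℝ) ≤ b := by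
      have := h.card_shared_le v hv w hw (Ne.symm hwv)
      have h2 : (univ.filter fun u => u ∉ H ∧ G.Adj u w ∧ G.Adj (p u) v).card ≤
          (univ.filter fun u => u ∉ H ∧ G.Adj u w ∧ (G.Adj u v ∨ G.Adj (p u) v)).card :=
        card_le_card (monotone_filter_right _ fun u _ hu => ⟨hu.1, hu.2.1, Or.inr hu.2.2⟩)
      exact_mod_cast h2.trans this
    have h0 : (0 : ℝ) ≤ (univ.filter fun u => u ∉ H ∧ G.Adj u w ∧ G.Adj (p u) v).card := by
      positivity
    rw [link, abs_le]
    split_ifs <;> constructor <;> linarith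
  intro v hv w₀ hw₀
  by_contra hne
  have hvw₀ : v ≠ w₀ := by
    rintro rfl
    exact hne (hself v)
  -- The integers have gap 1 around 0, so z is a genuine null vector near `hubVector`.
  obtain ⟨z, hz, hnear⟩ := hI.exists_eigenfunction_near zero_le_one (τ := 0) (fun m hm => by
    rw [sub_zero]
    have : m ≠ 0 := by exact_mod_cast hm
    exact_mod_cast Int.one_le_abs this) (hubVector G H p v)
  simp only [zero_mul, sub_zero, one_pow, one_mul] at hz hnear
  have hres : ∑ u, (∑ w ∈ univ.filter (G.Adj u), hubVector G H p v w) ^ 2 ≤ K * (1 + (b : ℝ)) ^ 2 := by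
    rw [← sum_subset (subset_univ H) fun u _ hu => by
      rw [h.sum_adj_hubVector_of_notMem hv hu]; norm_num]
    calc _ ≤ H.card • ((1 + (b : ℝ)) ^ 2) := by
          refine sum_le_card_nsmul _ _ _ fun w hw => ?_
          rw [sum_adj_hubVector_of_mem hv, ← sq_abs]
          have := hlink w hw v hv
          gcongr
      _ ≤ _ := by
          rw [nsmul_eq_mul]
          have : (H.card : ℝ) ≤ K := by exact_mod_cast h.card_hubs
          gcongr
  -- The error at a hub reappears with opposite sign at the leaf of each of its N arms, while the
  -- total squared error is bounded independently of N.
  have hclose : ∀ w ∈ H, |hubVector G H p v w - z w| ≤ ε := by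
    intro w hw
    set a := hubVector G H p v w - z w with ha
    set T := univ.filter fun u => u ∉ H ∧ G.Adj u w ∧
      (∀ w' ∈ H, G.Adj u w' → w' = w) ∧ ∀ w' ∈ H, ¬ G.Adj (p u) w' with hT
    have harm : ∀ u ∈ T, (hubVector G H p v (p u) - z (p u)) ^ 2 = a ^ 2 := by
      intro u hu
      obtain ⟨hu1, hu2, hu3, -⟩ := (mem_filter.1 hu).2
      have e1 := hz u
      have e2 := h.sum_adj_hubVector_of_notMem hv hu1
      rw [h.sum_adj_of_notMem _ hu1] at e1 e2
      have e3 : H.filter (G.Adj u) = {w} := by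
        ext w'
        simp only [mem_filter, mem_singleton]
        exact ⟨fun hh => hu3 w' hh.1 hh.2, fun e => e ▸ ⟨hw, hu2⟩⟩
      rw [e3, sum_singleton] at e1 e2
      have : hubVector G H p v (p u) - z (p u) = -a := by rw [ha]; linarith
      rw [this]; ring
    have hinj : Set.InjOn p (T : Set V) := by
      intro u hu u' hu' e
      have hu1 := (mem_filter.1 hu).2.1
      have hu1' := (mem_filter.1 hu').2.1
      rw [← h.partner_partner hu1, e, h.partner_partner hu1']
    have h1 : (T.card : ℝ) * a ^ 2 ≤ K * (1 + (b : ℝ)) ^ 2 := by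
      calc (T.card : ℝ) * a ^ 2 = ∑ u ∈ T, (hubVector G H p v (p u) - z (p u)) ^ 2 := by
            rw [sum_congr rfl harm, sum_const, nsmul_eq_mul]
        _ = ∑ x ∈ T.image p, (hubVector G H p v x - z x) ^ 2 := by rw [sum_image hinj]
        _ ≤ ∑ x, (hubVector G H p v x - z x) ^ 2 :=
            sum_le_sum_of_subset_of_nonneg (subset_univ _) fun _ _ _ => sq_nonneg _
        _ ≤ _ := hnear.trans hres
    have h2 : (N : ℝ) ≤ T.card := by exact_mod_cast h.le_card_arms w hw
    have h3 : K * (1 + (b : ℝ)) ^ 2 ≤ N * ε ^ 2 := by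
      rw [← div_le_iff₀ (by positivity)]
      linarith
    have h4 : (N : ℝ) * a ^ 2 ≤ N * ε ^ 2 :=
      (mul_le_mul_of_nonneg_right h2 (sq_nonneg a)).trans (h1.trans h3)
    have hN0 : (0 : ℝ) < N := by
      have : 0 ≤ K * (1 + (b : ℝ)) ^ 2 / ε ^ 2 := by positivity
      linarith
    exact abs_le_of_sq_le_sq (le_of_mul_le_mul_left h4 hN0) hε0.le
  -- Pair the null vector z with the hub vector of w₀, whose image under the adjacency operator is
  -- supported on the hubs. The term at v, a nonzero integer times nearly 1, cannot be cancelled by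
  -- the others.
  have hpair : ∑ w ∈ H, z w * link G H p w w₀ = 0 := by
    have e := sum_mul_adj_comm (F := G) z (hubVector G H p w₀)
    simp only [hz, zero_mul, sum_const_zero] at e
    rw [← e]
    rw [← sum_subset (subset_univ H) fun u _ hu => by
      rw [h.sum_adj_hubVector_of_notMem hw₀ hu, mul_zero]]
    exact sum_congr rfl fun w _ => by rw [sum_adj_hubVector_of_mem hw₀]
  have hzv : 1 - ε ≤ z v := by
    have := (abs_le.1 (hclose v hv)).2
    simp only [hubVector, hv, if_true] at this
    linarith
  have hone : 1 ≤ |link G H p v w₀| := by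
    obtain ⟨m, hm⟩ : ∃ m : ℤ, link G H p v w₀ = m := by
      refine ⟨(if G.Adj v w₀ then 1 else 0) -
        ((univ.filter fun u => u ∉ H ∧ G.Adj u v ∧ G.Adj (p u) w₀).card : ℤ), ?_⟩
      rw [link]
      push_cast
      rfl
    rw [hm] at hne ⊢
    have : m ≠ 0 := by exact_mod_cast hne
    exact_mod_cast Int.one_le_abs this
  have hrest : |∑ w ∈ H.erase v, z w * link G H p w w₀| ≤ K * (1 + b) * ε := by
    refine (abs_sum_le_sum_abs _ _).trans ?_
    calc _ ≤ (H.erase v).card • (ε * (1 + b)) := by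
          refine sum_le_card_nsmul _ _ _ fun w hw => ?_
          have hwH := mem_of_mem_erase hw
          have h1 := hclose w hwH
          simp only [hubVector, hwH, if_true, ne_of_mem_erase hw, if_false, zero_sub, abs_neg] at h1
          rw [abs_mul]
          have := hlink w hwH w₀ hw₀
          gcongr
      _ ≤ _ := by
          rw [nsmul_eq_mul]
          have : ((H.erase v).card : ℝ) ≤ K := by
            exact_mod_cast (card_le_card (erase_subset _ _)).trans h.card_hubs
          have h2 : ((H.erase v).card : ℝ) * (ε * (1 + b)) ≤ K * (ε * (1 + b)) := by gcongr
          linarith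
  rw [← add_sum_erase _ _ hv] at hpair
  have h5 : |z v * link G H p v w₀| ≤ K * (1 + b) * ε := by
    have : z v * link G H p v w₀ = -∑ w ∈ H.erase v, z w * link G H p w w₀ := by linarith
    rw [this, abs_neg]; exact hrest
  rw [abs_mul] at h5
  have h6 : 1 - ε ≤ |z v| * |link G H p v w₀| :=
    calc 1 - ε ≤ |z v| := hzv.trans (le_abs_self _)
      _ ≤ |z v| * |link G H p v w₀| := le_mul_of_one_le_right (abs_nonneg _) hone
  have h7 : ε * (2 * (1 + K * (1 + b))) = 1 := by
    rw [hε]; field_simp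
  nlinarith

/-- In an integral forest with very large hubs, hubs are not adjacent, and no matching edge outside
the hubs meets edges to hubs at both ends. -/
theorem not_adj_of_link_eq_zero (h : G.IsHubMatching H p K b N) (hG : G.IsAcyclic)
    (hlink : ∀ v ∈ H, ∀ w ∈ H, link G H p v w = 0) {v w : V} (hv : v ∈ H) (hw : w ∈ H) :
    ¬ G.Adj v w ∧ ∀ u ∉ H, G.Adj u v → ¬ G.Adj (p u) w := by
  have hl := hlink v hv w hw
  -- An edge and a path of length three between the same hubs would form a cycle, so the two kinds
  -- of connection cannot cancel in `link`.
  have hnadj : ¬ G.Adj v w := by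
    intro hadj
    rw [link, if_pos hadj] at hl
    have hc : (univ.filter fun u => u ∉ H ∧ G.Adj u v ∧ G.Adj (p u) w).card ≠ 0 := by
      intro h0
      rw [h0] at hl
      norm_num at hl
    obtain ⟨u, hu⟩ := Finset.card_ne_zero.1 hc
    obtain ⟨hu1, hu2, hu3⟩ := (mem_filter.1 hu).2
    have hup := h.adj_partner u hu1
    have hpH := h.partner_notMem u hu1
    have q1 : (Walk.cons hadj Walk.nil).IsPath := by simp [hadj.ne]
    have q2 : (Walk.cons hu2.symm (Walk.cons hup (Walk.cons hu3 Walk.nil))).IsPath := by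
      have n1 : v ≠ u := fun e => hu1 (e ▸ hv)
      have n2 : v ≠ p u := fun e => hpH (e ▸ hv)
      have n3 : u ≠ w := fun e => hu1 (e ▸ hw)
      have n4 : p u ≠ w := fun e => hpH (e ▸ hw)
      simp [n1, n2, n3, n4, hadj.ne, hup.ne]
    have := (hG.subsingleton_path v w).elim ⟨_, q1⟩ ⟨_, q2⟩
    have := congrArg (fun q : G.Path v w => q.1.length) this
    simp at this
  refine ⟨hnadj, fun u hu hu2 hu3 => ?_⟩
  rw [link, if_neg hnadj] at hl
  have hc : (univ.filter fun u => u ∉ H ∧ G.Adj u v ∧ G.Adj (p u) w).card = 0 := by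
    have : ((univ.filter fun u => u ∉ H ∧ G.Adj u v ∧ G.Adj (p u) w).card : ℝ) = 0 := by linarith
    exact_mod_cast this
  rw [card_eq_zero] at hc
  have : u ∈ univ.filter fun u => u ∉ H ∧ G.Adj u v ∧ G.Adj (p u) w :=
    mem_filter.2 ⟨mem_univ _, hu, hu2, hu3⟩
  rw [hc] at this
  simp at this

end IsHubMatching

end SimpleGraph

end

/-! ### Common neighbours of hubs and the bound on the nullity -/

section

open Finset
open scoped Matrix

namespace SimpleGraph

namespace IsHubMatching

variable {V : Type*} [Fintype V] [DecidableEq V] {G : SimpleGraph V} [DecidableRel G.Adj]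
  {H : Finset V} {p : V → V} {K b N : ℕ}

/-- The numbers of common neighbours of hubs outside the set of hubs. -/
def sharedMatrix (G : SimpleGraph V) [DecidableRel G.Adj] (H : Finset V) : Matrix H H ℝ :=
  Matrix.of fun v w => ((univ.filter fun u => u ∉ H ∧ G.Adj u v ∧ G.Adj u w).card : ℝ)

theorem isHermitian_sharedMatrix (G : SimpleGraph V) [DecidableRel G.Adj] (H : Finset V) :
    (sharedMatrix G H).IsHermitian := by
  ext v w
  simp only [sharedMatrix, Matrix.conjTranspose_apply, Matrix.of_apply, star_trivial]
  congr 3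
  ext u
  tauto

/-- Eigenvectors of the shared neighbour matrix extend to eigenfunctions of the graph. -/
theorem isRoot_of_sharedMatrix_eigenvector (h : G.IsHubMatching H p K b N)
    (hHH : ∀ v ∈ H, ∀ w ∈ H, ¬ G.Adj v w)
    (hHp : ∀ v ∈ H, ∀ w ∈ H, ∀ u ∉ H, G.Adj u v → ¬ G.Adj (p u) w) {ζ : H → ℝ} (hζ : ζ ≠ 0)
    {s t : ℝ} (hs : s ≠ 0) (hst : t ^ 2 = 1 + s) (hM : sharedMatrix G H *ᵥ ζ = s • ζ) :
    (G.adjMatrix ℝ).charpoly.IsRoot t := by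
  let ζ' : V → ℝ := fun x => if hx : x ∈ H then ζ ⟨x, hx⟩ else 0
  have hζ' : ∀ v : H, ζ' v = ζ v := fun v => by simp [ζ', v.2]
  let σ : V → ℝ := fun u => ∑ v ∈ H.filter (G.Adj u), ζ' v
  have hMσ : ∀ w ∈ H, ∑ u ∈ (univ \ H).filter (G.Adj w), σ u = s * ζ' w := by
    intro w hw
    have e := congrFun hM ⟨w, hw⟩
    rw [Pi.smul_apply, smul_eq_mul, ← hζ' ⟨w, hw⟩] at e
    rw [← e]
    simp only [Matrix.mulVec, dotProduct, sharedMatrix, Matrix.of_apply, σ]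
    simp_rw [← hζ']
    rw [sum_coe_sort H fun v => ((univ.filter fun u => u ∉ H ∧ G.Adj u w ∧ G.Adj u v).card : ℝ) * ζ' v]
    simp_rw [sum_filter (s := H)]
    rw [sum_comm]
    refine sum_congr rfl fun v _ => ?_
    rw [← sum_filter, sum_const, nsmul_eq_mul, filter_filter]
    congr 3
    ext u
    simp [G.adj_comm w u]
  -- On each matched pair this solves t z(x) - z(p x) = σ x together with the same equation at p x;
  -- the determinant is t² - 1 = s.
  let z : V → ℝ := fun x => if x ∈ H then ζ' x else (t * σ x + σ (p x)) / s
  have hzH : ∀ x ∈ H, z x = ζ' x := fun x hx => if_pos hx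
  have hzn : ∀ x ∉ H, z x = (t * σ x + σ (p x)) / s := fun x hx => if_neg hx
  apply isRoot_charpoly_of_eigenfunction (z := z)
  · intro h0
    apply hζ
    ext v
    rw [← hζ' v, ← hzH v v.2, h0]
    rfl
  · intro x
    by_cases hx : x ∈ H
    · rw [sum_adj_split (H := H), filter_false_of_mem fun w hw => hHH x hx w hw, sum_empty, zero_add,
        hzH x hx, sum_congr rfl (g := fun u => t / s * σ u), ← mul_sum, hMσ x hx]
      · field_simp
      · intro u hu
        have hu1 : u ∉ H := (mem_sdiff.1 (mem_filter.1 hu).1).2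
        have : σ (p u) = 0 := by
          simp only [σ]
          rw [filter_false_of_mem fun w hw => hHp x hx w hw u hu1 (mem_filter.1 hu).2.symm, sum_empty]
        rw [hzn u hu1, this]
        ring
    · have e : ∑ w ∈ H.filter (G.Adj x), z w = σ x :=
        sum_congr rfl fun w hw => hzH w (mem_filter.1 hw).1
      rw [h.sum_adj_of_notMem z hx, e, hzn x hx, hzn (p x) (h.partner_notMem x hx),
        h.partner_partner hx]
      field_simp
      linear_combination (-σ x) * hst

/-- In an integral forest with very large hubs, different hubs have no common neighbours. -/
theorem not_shared (b K : ℕ) : ∃ N₀ : ℕ, ∀ {V : Type*} [Fintype V] [DecidableEq V]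
    {G : SimpleGraph V} [DecidableRel G.Adj] {H : Finset V} {p : V → V} {N : ℕ},
    G.IsHubMatching H p K b N → N₀ ≤ N → G.HasIntegralSpectrum →
    (∀ v ∈ H, ∀ w ∈ H, ¬ G.Adj v w) →
    (∀ v ∈ H, ∀ w ∈ H, ∀ u ∉ H, G.Adj u v → ¬ G.Adj (p u) w) →
    ∀ v ∈ H, ∀ w ∈ H, v ≠ w → ∀ u ∉ H, G.Adj u v → ¬ G.Adj u w := by
  obtain ⟨N₀, hN₀⟩ := Matrix.IsHermitian.offDiag_eq_zero_of_sq b K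
  refine ⟨N₀, fun {V} _ _ {G} _ {H p N} h hN hI hHH hHp v hv w hw hvw u hu huv huw => ?_⟩
  have hM := isHermitian_sharedMatrix G H
  have key := hN₀ hM (by simpa using h.card_hubs) (fun i j => ⟨_, rfl⟩) ?_ ?_ ?_ ⟨v, hv⟩ ⟨w, hw⟩
    (by simpa using hvw)
  · simp only [sharedMatrix, Matrix.of_apply, Nat.cast_eq_zero, card_eq_zero] at key
    have : u ∈ univ.filter fun u => u ∉ H ∧ G.Adj u v ∧ G.Adj u w :=
      mem_filter.2 ⟨mem_univ _, hu, huv, huw⟩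
    rw [key] at this
    simp at this
  · rintro ⟨i, hi⟩
    have h1 := h.le_card_arms i hi
    simp only [sharedMatrix, Matrix.of_apply]
    have hle : (univ.filter fun u => u ∉ H ∧ G.Adj u i ∧ (∀ w ∈ H, G.Adj u w → w = i) ∧
        ∀ w ∈ H, ¬ G.Adj (p u) w).card ≤ (univ.filter fun u => u ∉ H ∧ G.Adj u i ∧ G.Adj u i).card :=
      card_le_card (monotone_filter_right _ fun u _ hu => ⟨hu.1, hu.2.1, hu.2.1⟩)
    exact_mod_cast (hN.trans h1).trans hle
  · rintro ⟨i, hi⟩ ⟨j, hj⟩ hij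
    have hij' : j ≠ i := fun e => hij (Subtype.ext e.symm)
    have h1 := h.card_shared_le j hj i hi hij'
    simp only [sharedMatrix, Matrix.of_apply]
    have hle : (univ.filter fun u => u ∉ H ∧ G.Adj u i ∧ G.Adj u j).card ≤
        (univ.filter fun u => u ∉ H ∧ G.Adj u i ∧ (G.Adj u j ∨ G.Adj (p u) j)).card :=
      card_le_card (monotone_filter_right _ fun u _ hu => ⟨hu.1, hu.2.1, Or.inl hu.2.2⟩)
    exact_mod_cast hle.trans h1
  -- A positive eigenvalue s yields the eigenvalue √(1 + s) of G, an integer by hypothesis.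
  · intro i hi
    set s := hM.eigenvalues i
    have hroot := h.isRoot_of_sharedMatrix_eigenvector hHH hHp
      (ζ := (hM.eigenvectorBasis i).ofLp) (s := s) (t := √(1 + s)) ?_ hi.ne'
      (Real.sq_sqrt (by linarith)) (hM.mulVec_eigenvectorBasis i)
    · obtain ⟨m, hm⟩ := hI _ hroot
      refine ⟨m.natAbs, ?_⟩
      rw [← Real.sq_sqrt (show 0 ≤ 1 + s by linarith), hm, Nat.cast_natAbs]
      push_cast
      rw [sq_abs]
    · intro h0
      have := hM.eigenvector_dotProduct_eigenvector i i
      rw [h0, if_pos rfl] at this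
      simp at this

/-- A graph consisting of a single hub with pendant paths has nullity at most one. -/
theorem nullity_le_one (h : G.IsHubMatching H p K b N) (hconn : G.Connected) (hne : H.Nonempty)
    (hHH : ∀ v ∈ H, ∀ w ∈ H, ¬ G.Adj v w)
    (hHp : ∀ v ∈ H, ∀ w ∈ H, ∀ u ∉ H, G.Adj u v → ¬ G.Adj (p u) w)
    (hsh : ∀ v ∈ H, ∀ w ∈ H, v ≠ w → ∀ u ∉ H, G.Adj u v → ¬ G.Adj u w) : G.nullity ≤ 1 := by
  obtain ⟨v, hv⟩ := hne
  -- The hub v with all matched pairs touching it. No edge leaves X, so by connectedness v is the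
  -- only hub.
  let X : Set V := {x | x = v ∨ x ∉ H ∧ (G.Adj x v ∨ G.Adj (p x) v)}
  have hX : ∀ x, x ∈ X := by
    intro x
    obtain ⟨q⟩ := hconn.preconnected v x
    by_contra hx
    obtain ⟨d, -, hd1, hd2⟩ := q.exists_boundary_dart X (Or.inl rfl) hx
    have hadj := d.adj
    apply hd2
    rcases hd1 with e | ⟨h1, h2⟩
    · rw [e] at hadj
      exact Or.inr ⟨fun hH => hHH v hv _ hH hadj, Or.inl hadj.symm⟩
    · rcases h.eq_or_mem _ h1 _ hadj with e | hH
      · right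
        rw [e]
        refine ⟨h.partner_notMem _ h1, ?_⟩
        rw [h.partner_partner h1]
        exact h2.symm
      · left
        by_contra hne
        rcases h2 with h2 | h2
        · exact hsh v hv _ hH (Ne.symm hne) _ h1 h2 hadj
        · exact hHp _ hH _ hv _ h1 hadj h2
  have hHv : ∀ w ∈ H, w = v := by
    intro w hw
    rcases hX w with e | e
    · exact e
    · exact absurd hw e.1
  -- A null vector vanishing at v vanishes at every other x: apply the equation at p x, whose only
  -- neighbour besides possibly v is x.
  let φ : LinearMap.ker (Matrix.toLin' (G.adjMatrix ℝ)) →ₗ[ℝ] ℝ :=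
    (LinearMap.proj v).comp (Submodule.subtype _)
  have hinj : Function.Injective φ := by
    rw [← LinearMap.ker_eq_bot, LinearMap.ker_eq_bot']
    intro z hz
    have hzv : z.1 v = 0 := hz
    have hker : ∀ u, ∑ w ∈ univ.filter (G.Adj u), z.1 w = 0 := by
      intro u
      have := congrFun (LinearMap.mem_ker.1 z.2) u
      rw [Matrix.toLin'_apply, adjMatrix_mulVec_apply, neighborFinset_eq_filter] at this
      exact this
    ext x
    change z.1 x = 0
    by_cases hx : x ∈ H
    · rw [hHv x hx, hzv]
    · have e := hker (p x)
      rw [h.sum_adj_of_notMem _ (h.partner_notMem x hx), h.partner_partner hx,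
        sum_eq_zero, add_zero] at e
      · exact e
      · intro w hw
        rw [hHv w (mem_filter.1 hw).1, hzv]
  have := LinearMap.finrank_le_finrank_of_injective hinj
  rwa [Module.finrank_self] at this

/-- An integral tree whose vertices outside some very large hubs are perfectly matched has nullity
at most one. -/
theorem exists_nullity_le_one (b K : ℕ) : ∃ N₀ : ℕ, ∀ {V : Type*} [Fintype V] [DecidableEq V]
    {G : SimpleGraph V} [DecidableRel G.Adj] {H : Finset V} {p : V → V} {N : ℕ},
    G.IsHubMatching H p K b N → N₀ ≤ N → H.Nonempty → G.IsTree → G.HasIntegralSpectrum →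
    G.nullity ≤ 1 := by
  obtain ⟨N₁, h1⟩ := link_eq_zero b K
  obtain ⟨N₂, h2⟩ := not_shared b K
  refine ⟨max N₁ N₂, fun {V} _ _ {G} _ {H p N} h hN hne hG hI => ?_⟩
  have hl := h1 h ((le_max_left _ _).trans hN) hG.2 hI
  have hHH : ∀ v ∈ H, ∀ w ∈ H, ¬ G.Adj v w := fun v hv w hw =>
    (h.not_adj_of_link_eq_zero hG.2 hl hv hw).1
  have hHp : ∀ v ∈ H, ∀ w ∈ H, ∀ u ∉ H, G.Adj u v → ¬ G.Adj (p u) w := fun v hv w hw =>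
    (h.not_adj_of_link_eq_zero hG.2 hl hv hw).2
  exact h.nullity_le_one hG.1 hne hHH hHp (h2 h ((le_max_right _ _).trans hN) hI hHH hHp)

end IsHubMatching

/-- Arms match mid vertices with leaves, and the remainder brings its own matching. An arm touches
only its own hub, so vertices involved with two hubs lie in Q; this bounds them by b. -/
theorem IsHubDecomposition.exists_isHubMatching {V : Type*} [Fintype V] [DecidableEq V]
    {G : SimpleGraph V} [DecidableRel G.Adj] {H Q Y : Finset V} {hub lf : V → V} {K b N : ℕ}
    (h : G.IsHubDecomposition H Q Y hub lf K b N)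
    (hQ : ∀ q ∈ Q, ∃ q' ∈ Q, G.Adj q q' ∧ ∀ z ∈ Q, G.Adj q z → z = q') :
    ∃ p, G.IsHubMatching H p K b N := by
  have hp : ∀ x, ∃ x', x ∉ H → x' ∉ H ∧ G.Adj x x' ∧ ∀ z, G.Adj x z → z = x' ∨ z ∈ H := by
    intro x
    by_cases hx : x ∈ H
    · exact ⟨x, fun h => absurd hx h⟩
    rcases h.cover x with h1 | h1 | h1 | ⟨y, hy, rfl⟩
    · exact absurd h1 hx
    · obtain ⟨q', h2, h3, h4⟩ := hQ x h1
      refine ⟨q', fun _ => ⟨fun hH => h.disjoint _ hH h2, h3, fun z hz => ?_⟩⟩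
      rcases h.cover z with e | e | e | ⟨y, hy, rfl⟩
      · exact Or.inr e
      · exact Or.inl (h4 z e hz)
      · exact absurd hz (h.not_adj_rest_mid h1 e)
      · exact absurd hz (h.not_adj_leaf (fun hY => (h.mid_notMem x hY).2 h1) hy)
    · refine ⟨lf x, fun _ => ⟨(h.leaf_notMem x h1).1, ((h.isArm x h1).adj_mid _).2 (Or.inr rfl),
        fun z hz => ?_⟩⟩
      rcases ((h.isArm x h1).adj_mid z).1 hz with e | e
      · exact Or.inr (e ▸ h.hub_mem x h1)
      · exact Or.inl e
    · refine ⟨y, fun _ => ⟨(h.mid_notMem y hy).1, ((h.isArm y hy).adj_leaf _).2 rfl,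
        fun z hz => Or.inl (((h.isArm y hy).adj_leaf z).1 hz)⟩⟩
  choose p hp using hp
  have hpY : ∀ y ∈ Y, p y = lf y := by
    intro y hy
    obtain ⟨h1, h2, -⟩ := hp y (h.mid_notMem y hy).1
    rcases ((h.isArm y hy).adj_mid _).1 h2 with e | e
    · exact absurd (h.hub_mem y hy) (e ▸ h1)
    · exact e
  have hleafH : ∀ y ∈ Y, ∀ w ∈ H, ¬ G.Adj (lf y) w := by
    intro y hy w hw hadj
    rw [(h.isArm y hy).adj_leaf] at hadj
    exact (h.mid_notMem y hy).1 (hadj ▸ hw)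
  have hmidH : ∀ y ∈ Y, ∀ w ∈ H, G.Adj y w → w = hub y := by
    intro y hy w hw hadj
    rcases ((h.isArm y hy).adj_mid w).1 hadj with e | e
    · exact e
    · exact absurd hw (e ▸ (h.leaf_notMem y hy).1)
  refine ⟨p, h.card_hubs, fun x hx => (hp x hx).1, fun x hx => (hp x hx).2.1,
    fun x hx => (hp x hx).2.2, fun v hv => ?_, fun v hv w hw hvw => ?_⟩
  · refine (h.le_card_arms v hv).trans (card_le_card fun y hy => ?_)
    obtain ⟨hyY, e⟩ := mem_filter.1 hy
    refine mem_filter.2 ⟨mem_univ _, (h.mid_notMem y hyY).1, ?_, fun w hw hadj => ?_, fun w hw => ?_⟩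
    · exact ((h.isArm y hyY).adj_mid v).2 (Or.inl e.symm)
    · rw [hmidH y hyY w hw hadj, e]
    · rw [hpY y hyY]
      exact hleafH y hyY w hw
  · refine (card_le_card fun u hu => ?_).trans h.card_rest
    obtain ⟨hu1, hu2, hu3⟩ := (mem_filter.1 hu).2
    rcases h.cover u with h1 | h1 | h1 | ⟨y, hy, rfl⟩
    · exact absurd h1 hu1
    · exact h1
    · exfalso
      rcases hu3 with hu3 | hu3
      · exact hvw ((hmidH u h1 v hv hu3).trans (hmidH u h1 w hw hu2).symm)
      · rw [hpY u h1] at hu3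
        exact hleafH u h1 v hv hu3
    · exact absurd hu2 (hleafH y hy w hw)

/-- An integral tree with very large hubs has nullity at most one. -/
theorem IsHubDecomposition.exists_nullity_le_one (b K : ℕ) : ∃ N₀ : ℕ, ∀ {V : Type*} [Fintype V]
    [DecidableEq V] {G : SimpleGraph V} [DecidableRel G.Adj] {H Q Y : Finset V} {hub lf : V → V}
    {N : ℕ}, G.IsHubDecomposition H Q Y hub lf K b N → N₀ ≤ N → H.Nonempty → G.IsTree →
    G.HasIntegralSpectrum → G.nullity ≤ 1 := by
  obtain ⟨δ, hδ, hperron⟩ := exists_uniform_component_perron b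
  obtain ⟨N₁, h1⟩ := IsHubDecomposition.perron_eq_one b K hδ
  obtain ⟨N₂, h2⟩ := IsHubMatching.exists_nullity_le_one b K
  refine ⟨max N₁ N₂, fun {V} _ _ {G} _ {H Q Y hub lf N} h hN hne hG hI => ?_⟩
  -- Perron eigenvalue 1 makes f equal at adjacent vertices of U. A second neighbour z of q would
  -- give f q ≥ f q' + f z > f q' ≥ f q.
  have hQ : ∀ q ∈ Q, ∃ q' ∈ Q, G.Adj q q' ∧ ∀ z ∈ Q, G.Adj q z → z = q' := by
    intro q hq
    obtain ⟨U, f, τ, hqU, hUQ, hcl, hfU, hf0, hτ, hτδ, hgap, hf⟩ :=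
      hperron G Q h.card_rest q hq
    have hτ1 := h1 h ((le_max_left _ _).trans hN) hne hG.1 hI ⟨q, hqU⟩ hUQ hcl hfU hf0 hτ hτδ
      hgap hf
    subst hτ1
    have hfnn : ∀ u, 0 ≤ f u := by
      intro u
      by_cases hu : u ∈ U
      · exact hδ.le.trans (hfU u hu).1
      · rw [hf0 u hu]
    have hpos : ∀ u ∈ U, 0 < f u := fun u hu => hδ.trans_le (hfU u hu).1
    have hle : ∀ u ∈ U, ∀ w, G.Adj u w → f w ≤ f u := by
      intro u hu w huw
      have := single_le_sum (f := f) (fun w _ => hfnn w)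
        (mem_filter.2 ⟨mem_univ w, huw⟩)
      rwa [hf u hu, one_mul] at this
    have hne0 : ∑ w ∈ univ.filter (G.Adj q), f w ≠ 0 := by
      rw [hf q hqU, one_mul]; exact (hpos q hqU).ne'
    obtain ⟨q', hq', hfq'⟩ := exists_ne_zero_of_sum_ne_zero hne0
    have hadj : G.Adj q q' := (mem_filter.1 hq').2
    have hq'U : q' ∈ U := by
      by_contra hn
      exact hfq' (hf0 q' hn)
    refine ⟨q', hUQ hq'U, hadj, fun z hz hqz => ?_⟩
    by_contra hzq
    have hzU := hcl q hqU z hz hqz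
    have hsub : ({q', z} : Finset V) ⊆ univ.filter (G.Adj q) := by
      intro x hx
      rw [mem_insert, mem_singleton] at hx
      rcases hx with rfl | rfl
      · exact hq'
      · exact mem_filter.2 ⟨mem_univ _, hqz⟩
    have e := sum_le_sum_of_subset_of_nonneg hsub fun w _ _ => hfnn w
    rw [sum_pair (Ne.symm hzq), hf q hqU, one_mul] at e
    have e1 := hle q' hq'U q hadj.symm
    have e2 := hpos z hzU
    linarith
  obtain ⟨p, hp⟩ := h.exists_isHubMatching hQ
  exact h2 hp ((le_max_right _ _).trans hN) hne hG hI

/-- Integral trees of given nullity at least two have bounded size. -/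
theorem exists_card_le_of_nullity (h : ℕ) (hh : 2 ≤ h) : ∃ B : ℕ, ∀ (V : Type*) [Fintype V]
    [DecidableEq V] (G : SimpleGraph V) [DecidableRel G.Adj], G.IsTree → G.HasIntegralSpectrum →
    G.nullity = h → Fintype.card V ≤ B := by
  -- The defect 4h of the multiplicity bound, times 3 for the core and 3 for the arms.
  set K := 3 * (3 * (4 * h)) with hK
  -- Φ L is the hub size sufficient for a remainder of size K (1 + 2 L); the gap lemma finds a scale
  -- L at which the hubs are that large.
  choose Φ hΦ using fun L : ℕ => IsHubDecomposition.exists_nullity_le_one (K * (1 + 2 * L)) K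
  obtain ⟨M, hM⟩ := Finset.exists_gap Φ K 0
  refine ⟨max 2 (K * (1 + 2 * M)), fun V _ _ G _ hG hI hnull => ?_⟩
  by_contra hlt
  rw [not_le, max_lt_iff] at hlt
  obtain ⟨θ, hθ, hcard⟩ := hG.exists_sign_card_le hI
  have hθ0 : θ ≠ 0 := by
    rintro rfl
    norm_num at hθ
  have hdim := card_eigenvalues_le_finrank_eigenfunctions G θ
  rw [hnull] at hcard
  obtain ⟨C, hC3, hC⟩ := hG.2.exists_core hθ0 (t := 4 * h) (by omega)
  obtain ⟨C', hC'3, hC'⟩ := hG.exists_arms hlt.1 hC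
  obtain ⟨L, H, Q, Y, hub, lf, hne, hdec⟩ := exists_isHubDecomposition (K := K) (by omega) hC'
    (Φ := Φ) (M := M) (fun S N hS => hM S N hS) hlt.2
  have := hΦ L hdec le_rfl hne hG hI
  omega

end SimpleGraph

end

theorem theorem3 (h : ℕ) (hh : 2 ≤ h) :
    ∃ S : Finset (Σ n : ℕ, SimpleGraph (Fin n)),
      ∀ (V : Type*) [Fintype V] [DecidableEq V] (G : SimpleGraph V) [DecidableRel G.Adj],
        G.IsTree → G.HasIntegralSpectrum → G.nullity = h →
          ∃ H ∈ S, Nonempty (G ≃g H.2) := by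
  classical
  obtain ⟨B, hB⟩ := SimpleGraph.exists_card_le_of_nullity h hh
  refine ⟨(Finset.range (B + 1)).sigma fun n => Finset.univ, fun V _ _ G _ hG hI hnull => ?_⟩
  refine ⟨⟨Fintype.card V, G.map (Fintype.equivFin V).toEmbedding⟩, ?_,
    ⟨SimpleGraph.Iso.map (Fintype.equivFin V) G⟩⟩
  simp only [Finset.mem_sigma, Finset.mem_range, Finset.mem_univ, and_true]
  exact Nat.lt_succ_of_le (hB V G hG hI hnull)
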